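/- Let $X$ be a second countable, locally compact, Hausdorff space and $\sigma\colon X\to X$ a local homeomorphism (not necessarily surjective). Let $$\Gamma=\Gamma(X,\sigma)=\{(x,m,y)\in X\times\mathbf Z\times X : \text{there are } k,l\ge 0 \text{ with } \sigma^k(x)=\sigma^l(y),\ k-l=m\}$$ be the groupoid with $r(x,m,y)=x$, $s(x,m,y)=y$, $(x,m,y)(y,n,z)=(x,m+n,z)$, $(x,m,y)^{-1}=(y,-m,x)$, unit space $X$ (identified with $\{(x,0,x)\}$), and the topology with basis the sets $\{(x,k-l,y) : x\in U,\ y\in V,\ \sigma^k(x)=\sigma^l(y)\}$, where $U,V\subset X$ are open and $k,l\ge 0$. Put $X_{k,l}=\{(x,k-l,y):\sigma^k(x)=\sigma^l(y)\}$. A twist over $\Gamma$ is a principal circle bundle $\Lambda\to\Gamma$ whose total space is a topological groupoid with unit space $X$, such that the projection is a groupoid homomorphism that is the identity on units and $(z\lambda)(w\mu)=zw(\lambda\mu)$ for $z,w\in\mathbf T$ and composable $\lambda,\mu$. Two twists are isomorphic if there is a multiplicative, $\mathbf T$-equivariant homeomorphism between them covering the identity of $\Gamma$. Let $\mathrm{Tw}(\Gamma)$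 be the abelian group of isomorphism classes of twists under Baer sum, that is, $\{(a,b)\in\Lambda\times\Lambda' \text{ over the same point of }\Gamma\}/\big((za,b)\sim(a,zb)\big)$ with the product $[a,b][a',b']=[aa',bb']$. Let $H^1(X,\mathcal S)$ be the abelian group of isomorphism classes of principal circle bundles over $X$, with the product that sends $T,T'$ to $T\times_X T'/\big((zt,t')\sim(t,zt')\big)$. Let $j\colon X\to\Gamma$, $j(x)=(x,1,\sigma(x))$. **Theorem.** The map $\Lambda\mapsto j^*(\Lambda)$ induces a group isomorphism from $\mathrm{Tw}(\Gamma)$ onto $H^1(X,\mathcal S)$. Its inverse sends the class of a principal circle bundle $p\colon T\to X$ to the class of the following twist $\Lambda_T$; in particular, $\Lambda_T$ is a twist. For $k,l\ge0$ let $T_{k,l}$ be the circle bundle over $X_{k,l}$ whose points over $(x,k-l,y)$ are the classes $z\,(u_1,\dots,u_k,\overline{v_l},\dots,\overline{v_1})$ with $z\in\mathbf T$, $u_i,v_i\in T$, $p(u_i)=\sigma^{i-1}(x)$, $p(v_i)=\sigma^{i-1}(y)$, where scalars may be moved between $z$ and the entries according to $\overline{wv}=\overline w\,\overline v$ for $w\in\mathbf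 T$ (the quotient of the subspace of $\mathbf T\times\Gamma\times T^k\times T^l$; this is the pullback of $T^k\star\overline T{}^l$ along $(x,k-l,y)\mapsto(x,\sigma(x),\dots,\sigma^{k-1}(x),\sigma^{l-1}(y),\dots,y)$, and $T_{0,0}=X\times\mathbf T$). For $t_1=zt_2$ in one fibre of $T$ write $t_1\overline{t_2}=z$. The space $\Lambda_T$ is the quotient of $\bigsqcup_{k,l}T_{k,l}$ in which, over $X_{k,l}$, $$(u_1,\dots,u_{k+1},\overline{v_{l+1}},\dots,\overline{v_1})\sim u_{k+1}\overline{v_{l+1}}\,(u_1,\dots,u_k,\overline{v_l},\dots,\overline{v_1}),$$ with the operations $$(t_1,\dots,t_i,\overline{u_k},\dots,\overline{u_1})(v_1,\dots,v_k,\overline{w_l},\dots,\overline{w_1})=\Big(\prod_{n=1}^k v_n\overline{u_n}\Big)(t_1,\dots,t_i,\overline{w_l},\dots,\overline{w_1}),$$ $$(u_1,\dots,u_k,\overline{v_l},\dots,\overline{v_1})^{-1}=(v_1,\dots,v_l,\overline{u_k},\dots,\overline{u_1}).$$ -/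

import Mathlib

open Set Filter Topology

universe u

noncomputable section

namespace CircleTwist

/-! ## Principal circle bundles -/

/-- A principal circle bundle over `B`: a space `E` with a continuous action of the circle group
and a projection onto `B` that is equivariantly locally isomorphic to `U × Circle → U`. -/
structure CircleBundle (B : Type u) [TopologicalSpace B] : Type (u + 1) where
  E : Type u
  [top : TopologicalSpace E]
  act : Circle → E → E
  act_one : ∀ x, act 1 x = x
  act_mul : ∀ z w x, act (z * w) x = act z (act w x)
  continuous_act : Continuous fun q : Circle × E => act q.1 q.2
  proj : E → B
  proj_act : ∀ z x, proj (act z x) = proj x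
  locTriv : ∀ b : B, ∃ e : Bundle.Trivialization Circle proj, b ∈ e.baseSet ∧
    ∀ z x, proj x ∈ e.baseSet → (e (act z x)).2 = z * (e x).2

attribute [instance] CircleBundle.top

instance {B : Type u} [TopologicalSpace B] (P : CircleBundle B) : MulAction Circle P.E where
  smul := P.act
  one_smul := P.act_one
  mul_smul := P.act_mul

instance {B : Type u} [TopologicalSpace B] (P : CircleBundle B) : ContinuousSMul Circle P.E :=
  ⟨P.continuous_act⟩

lemma CircleBundle.proj_smul {B : Type u} [TopologicalSpace B] (P : CircleBundle B)
    (z : Circle) (x : P.E) : P.proj (z • x) = P.proj x := P.proj_act z x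

namespace CircleBundle

variable {B : Type u} [TopologicalSpace B]

/-- Isomorphism of principal circle bundles over `B`: an equivariant homeomorphism that covers
the identity of `B`. -/
structure Iso (P Q : CircleBundle B) : Type u extends P.E ≃ₜ Q.E where
  proj_map : ∀ x, Q.proj (toFun x) = P.proj x
  map_smul : ∀ (z : Circle) (x), toFun (z • x) = z • toFun x

lemma exists_local (P : CircleBundle B) (b : B) :
    ∃ U : Set B, IsOpen U ∧ b ∈ U ∧ ∃ (c : P.E → Circle) (s : B → P.E),
      ContinuousOn c (P.proj ⁻¹' U) ∧ ContinuousOn s U ∧ (∀ a ∈ U, P.proj (s a) = a) ∧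
      (∀ (z : Circle) (x), P.proj x ∈ U → c (z • x) = z * c x) ∧
      (∀ x y, P.proj x ∈ U → P.proj x = P.proj y → c x = c y → x = y) := by
  obtain ⟨e, hb, he⟩ := P.locTriv b
  refine ⟨e.baseSet, e.open_baseSet, hb, fun x => (e x).2,
    fun a => e.toOpenPartialHomeomorph.symm (a, 1), ?_, ?_, ?_, he, ?_⟩
  · rw [← e.source_eq]
    exact continuous_snd.comp_continuousOn e.continuousOn_toFun
  · refine e.toOpenPartialHomeomorph.continuousOn_symm.comp
      (continuousOn_id.prodMk continuousOn_const) ?_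
    intro a ha
    simpa [e.target_eq] using ha
  · intro a ha
    exact e.proj_symm_apply' ha
  · intro x y hx hxy hc
    have hy : P.proj y ∈ e.baseSet := hxy ▸ hx
    apply e.injOn (e.mem_source.2 hx) (e.mem_source.2 hy)
    apply Prod.ext
    · exact (e.coe_fst' hx).trans (hxy.trans (e.coe_fst' hy).symm)
    · exact hc

lemma continuous_proj (P : CircleBundle B) : Continuous P.proj := by
  rw [continuous_iff_continuousAt]
  intro x
  obtain ⟨e, hb, -⟩ := P.locTriv (P.proj x)
  exact e.continuousAt_proj (e.mem_source.2 hb)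

lemma exists_smul (P : CircleBundle B) {x y : P.E} (h : P.proj x = P.proj y) :
    ∃ z : Circle, y = z • x := by
  obtain ⟨U, -, hb, c, s, -, -, -, h1, h2⟩ := P.exists_local (P.proj x)
  refine ⟨c y / c x, h2 _ _ (h ▸ hb) (h.symm.trans (P.proj_smul _ _).symm) ?_⟩
  rw [h1 _ _ hb]
  simp

lemma smul_inj (P : CircleBundle B) {z w : Circle} {x : P.E} (h : z • x = w • x) : z = w := by
  obtain ⟨U, -, hb, c, s, -, -, -, h1, h2⟩ := P.exists_local (P.proj x)
  have := congrArg c h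
  rw [h1 _ _ hb, h1 _ _ hb] at this
  exact mul_right_cancel this

/-- Recognition of principal circle bundles: local equivariant circle-valued coordinates together
with local continuous sections give local trivializations. -/
lemma locTriv_of {E : Type u} [TopologicalSpace E] {m : Circle → E → E}
    (hm : Continuous fun q : Circle × E => m q.1 q.2)
    {p : E → B} (hp : Continuous p) (hpm : ∀ z x, p (m z x) = p x)
    (ht : ∀ x y, p x = p y → ∃ z : Circle, y = m z x) {b : B} {U : Set B} (hU : IsOpen U)
    (hb : b ∈ U) {c : E → Circle} {s : B → E}
    (hc : ContinuousOn c (p ⁻¹' U)) (hs : ContinuousOn s U) (hps : ∀ a ∈ U, p (s a) = a)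
    (hcs : ∀ z x, p x ∈ U → c (m z x) = z * c x) :
    ∃ e : Bundle.Trivialization Circle p, b ∈ e.baseSet ∧
      ∀ z x, p x ∈ e.baseSet → (e (m z x)).2 = z * (e x).2 := by
  refine ⟨{ toFun := fun x => (p x, c x)
            invFun := fun q => m (q.2 / c (s q.1)) (s q.1)
            source := p ⁻¹' U
            target := U ×ˢ univ
            map_source' := fun x hx => ⟨hx, mem_univ _⟩
            map_target' := ?_
            left_inv' := ?_
            right_inv' := ?_
            open_source := hU.preimage hp
            open_target := hU.prod isOpen_univ
            continuousOn_toFun := hp.continuousOn.prodMk hc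
            continuousOn_invFun := ?_
            baseSet := U
            open_baseSet := hU
            source_eq := rfl
            target_eq := rfl
            proj_toFun := fun _ _ => rfl }, hb, hcs⟩
  · rintro ⟨a, z⟩ ⟨ha, -⟩
    simpa [hpm, hps a ha] using ha
  · intro x hx
    obtain ⟨z, hz⟩ := ht (s (p x)) x (hps _ hx)
    have h1 : c x = z * c (s (p x)) := by
      conv_lhs => rw [hz]
      exact hcs _ _ (by rw [hps _ hx]; exact hx)
    simp only [h1, mul_div_cancel_right]
    exact hz.symm
  · rintro ⟨a, z⟩ ⟨ha, -⟩
    have ha' : p (s a) = a := hps a ha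
    simp only [hpm, ha']
    rw [hcs _ _ (by rw [ha']; exact ha)]
    simp
  · have h1 : ContinuousOn (fun q : B × Circle => s q.1) (U ×ˢ univ) :=
      hs.comp continuous_fst.continuousOn (fun q hq => hq.1)
    have h2 : ContinuousOn (fun q : B × Circle => c (s q.1)) (U ×ˢ univ) :=
      hc.comp h1 (fun q hq => by
        change p (s q.1) ∈ U
        rw [hps _ hq.1]; exact hq.1)
    exact hm.comp_continuousOn ((continuous_snd.continuousOn.div' h2).prodMk h1)

/-- A continuous equivariant map over `B` between principal circle bundles. -/
structure Hom (P Q : CircleBundle B) where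
  toFun : P.E → Q.E
  cont : Continuous toFun
  proj_map : ∀ x, Q.proj (toFun x) = P.proj x
  map_smul : ∀ (z : Circle) (x), toFun (z • x) = z • toFun x

lemma Hom.bijective {P Q : CircleBundle B} (f : Hom P Q) : Function.Bijective f.toFun := by
  constructor
  · intro x y hxy
    obtain ⟨z, rfl⟩ := P.exists_smul (x := x) (y := y)
      (by rw [← f.proj_map, ← f.proj_map, hxy])
    rw [f.map_smul] at hxy
    have : (1 : Circle) = z := Q.smul_inj (by rw [_root_.one_smul]; exact hxy)
    rw [← this, _root_.one_smul]
  · intro y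
    obtain ⟨U, -, hb, c, s, -, -, hs, -, -⟩ := P.exists_local (Q.proj y)
    obtain ⟨z, hz⟩ := Q.exists_smul (x := f.toFun (s (Q.proj y))) (y := y)
      (by rw [f.proj_map, hs _ hb])
    exact ⟨z • s (Q.proj y), by rw [f.map_smul, ← hz]⟩

/-- Every continuous equivariant map over `B` is an isomorphism. -/
def Hom.iso {P Q : CircleBundle B} (f : Hom P Q) : Iso P Q where
  toEquiv := Equiv.ofBijective f.toFun f.bijective
  continuous_toFun := f.cont
  continuous_invFun := by
    rw [continuous_iff_continuousAt]
    intro y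
    obtain ⟨U, hU, hb, -, s, -, hsc, hs, -, -⟩ := P.exists_local (Q.proj y)
    obtain ⟨V, hV, hb', c, -, hc, -, -, hcz, hinj⟩ := Q.exists_local (Q.proj y)
    have hW : IsOpen (U ∩ V) := hU.inter hV
    have hpre : Q.proj ⁻¹' (U ∩ V) ∈ 𝓝 y := (hW.preimage Q.continuous_proj).mem_nhds ⟨hb, hb'⟩
    have h1 : ContinuousOn (fun y => s (Q.proj y)) (Q.proj ⁻¹' (U ∩ V)) :=
      hsc.comp Q.continuous_proj.continuousOn (fun _ h => h.1)
    have h2 : ContinuousOn (fun y => c (f.toFun (s (Q.proj y)))) (Q.proj ⁻¹' (U ∩ V)) :=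
      hc.comp (f.cont.comp_continuousOn h1) (fun y h => by
        change Q.proj _ ∈ V
        rw [f.proj_map, hs _ h.1]; exact h.2)
    have h3 : ContinuousOn (fun y => (c y / c (f.toFun (s (Q.proj y)))) • s (Q.proj y))
        (Q.proj ⁻¹' (U ∩ V)) := ((hc.mono (fun _ h => h.2)).div' h2).smul h1
    refine (h3.continuousAt hpre).congr ?_
    filter_upwards [hpre] with y' hy'
    apply f.bijective.1
    change f.toFun _ = f.toFun ((Equiv.ofBijective f.toFun f.bijective).symm y')
    rw [Equiv.ofBijective_apply_symm_apply f.toFun f.bijective y', f.map_smul]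
    have hpf : Q.proj (f.toFun (s (Q.proj y'))) = Q.proj y' := by rw [f.proj_map, hs _ hy'.1]
    refine hinj _ _ (by rw [Q.proj_smul, hpf]; exact hy'.2) (by rw [Q.proj_smul, hpf]) ?_
    rw [hcz _ _ (by rw [hpf]; exact hy'.2)]
    simp
  proj_map := f.proj_map
  map_smul := f.map_smul

/-- The homomorphism underlying an isomorphism. -/
def Iso.hom {P Q : CircleBundle B} (f : Iso P Q) : Hom P Q :=
  ⟨f.toFun, f.continuous_toFun, f.proj_map, f.map_smul⟩

/-- The inverse of an isomorphism, as a homomorphism. -/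
def Iso.inv {P Q : CircleBundle B} (f : Iso P Q) : Hom Q P where
  toFun := f.invFun
  cont := f.continuous_invFun
  proj_map y := by
    have := f.proj_map (f.invFun y)
    rw [f.right_inv] at this
    exact this.symm
  map_smul z y := by
    apply f.toEquiv.injective
    change f.toFun _ = f.toFun _
    rw [f.map_smul, f.right_inv, f.right_inv]

/-- Composition of homomorphisms. -/
def Hom.comp {P Q R : CircleBundle B} (g : Hom Q R) (f : Hom P Q) : Hom P R where
  toFun := g.toFun ∘ f.toFun
  cont := g.cont.comp f.cont
  proj_map x := by simp [g.proj_map, f.proj_map]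
  map_smul z x := by simp [g.map_smul, f.map_smul]

/-- The identity homomorphism. -/
def Hom.id (P : CircleBundle B) : Hom P P := ⟨_root_.id, continuous_id, fun _ => rfl, fun _ _ => rfl⟩

/-- The pullback of a principal circle bundle along a continuous map. -/
def pullback {A : Type u} [TopologicalSpace A] (f : A → B) (hf : Continuous f)
    (P : CircleBundle B) : CircleBundle A where
  E := {q : A × P.E // f q.1 = P.proj q.2}
  act z q := ⟨(q.1.1, z • q.1.2), q.2.trans (P.proj_smul z q.1.2).symm⟩
  act_one q := Subtype.ext (Prod.ext rfl (P.act_one _))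
  act_mul z w q := Subtype.ext (Prod.ext rfl (P.act_mul _ _ _))
  continuous_act := by fun_prop
  proj q := q.1.1
  proj_act _ _ := rfl
  locTriv a := by
    obtain ⟨U, hU, hb, c, s, hc, hsc, hs, hcz, -⟩ := P.exists_local (f a)
    classical
    have key : ∀ a' : A, ∃ q : {q : A × P.E // f q.1 = P.proj q.2},
        f a' ∈ U → q.1 = (a', s (f a')) := by
      intro a'
      by_cases h : f a' ∈ U
      · exact ⟨⟨(a', s (f a')), (hs _ h).symm⟩, fun _ => rfl⟩
      · exact ⟨⟨(a, s (f a)), (hs _ hb).symm⟩, fun h' => absurd h' h⟩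
    choose t ht using key
    refine locTriv_of (p := fun q : {q : A × P.E // f q.1 = P.proj q.2} => q.1.1)
      (m := fun z q => ⟨(q.1.1, z • q.1.2), q.2.trans (P.proj_smul z q.1.2).symm⟩)
      (U := f ⁻¹' U) (c := fun q => c q.1.2) (s := t)
      (by fun_prop) (by fun_prop) (fun _ _ => rfl) ?_ (hU.preimage hf) hb ?_ ?_ ?_ ?_
    · rintro ⟨⟨x, e⟩, h⟩ ⟨⟨y, e'⟩, h'⟩ hxy
      simp only at hxy h h'
      subst hxy
      obtain ⟨z, rfl⟩ := P.exists_smul (h.symm.trans h')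
      exact ⟨z, rfl⟩
    · refine hc.comp (by fun_prop) ?_
      intro q hq
      change P.proj q.1.2 ∈ U
      rw [← q.2]; exact hq
    · refine (Topology.IsInducing.continuousOn_iff
        (Topology.IsInducing.subtypeVal (t := fun _ => _))).2 ?_
      have : ContinuousOn (fun a' => (a', s (f a'))) (f ⁻¹' U) :=
        continuousOn_id.prodMk (hsc.comp hf.continuousOn (fun _ h => h))
      exact this.congr (fun a' h => ht a' h)
    · intro a' h
      exact congrArg Prod.fst (ht a' h)
    · intro z q hq
      refine hcz z q.1.2 ?_
      rw [← q.2]; exact hq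

/-- The trivial circle bundle `B × Circle`. -/
def trivial (B : Type u) [TopologicalSpace B] : CircleBundle B where
  E := B × Circle
  act z q := (q.1, z * q.2)
  act_one q := Prod.ext rfl (one_mul _)
  act_mul z w q := Prod.ext rfl (mul_assoc _ _ _)
  continuous_act := by fun_prop
  proj := Prod.fst
  proj_act _ _ := rfl
  locTriv b := by
    refine locTriv_of (U := univ) (m := fun z (q : B × Circle) => (q.1, z * q.2))
      (c := Prod.snd) (s := fun b => (b, 1)) (by fun_prop) continuous_fst (fun _ _ => rfl) ?_
      isOpen_univ (mem_univ _) continuous_snd.continuousOn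
      (Continuous.continuousOn (by fun_prop)) (fun _ _ => rfl) (fun _ _ _ => rfl)
    rintro ⟨x, z⟩ ⟨y, w⟩ h
    simp only at h
    subst h
    exact ⟨w / z, Prod.ext rfl (by simp)⟩

/-- The conjugate circle bundle: the same space, with `z` acting as `z⁻¹`. -/
def conj (P : CircleBundle B) : CircleBundle B where
  E := P.E
  act z x := z⁻¹ • x
  act_one x := by simp
  act_mul z w x := by rw [smul_smul, mul_inv]
  continuous_act := by fun_prop
  proj := P.proj
  proj_act z x := P.proj_smul z⁻¹ x
  locTriv b := by
    obtain ⟨U, hU, hb, c, s, hc, hsc, hs, hcz, -⟩ := P.exists_local b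
    refine locTriv_of (m := fun z (x : P.E) => z⁻¹ • x) (c := fun x => (c x)⁻¹) (by fun_prop) P.continuous_proj
      (fun z x => P.proj_smul z⁻¹ x) ?_ hU hb hc.inv hsc hs ?_
    · intro x y h
      obtain ⟨z, hz⟩ := P.exists_smul h
      exact ⟨z⁻¹, by simpa using hz⟩
    · intro z x hx
      simp [hcz z⁻¹ x hx, mul_comm]

/-- The fibre product of two bundles over `B`. -/
abbrev FibreProd (P Q : CircleBundle B) : Type u := {q : P.E × Q.E // P.proj q.1 = Q.proj q.2}

/-- The relation `(z x, y) ∼ (x, z y)`, written as `(x, y) ∼ (z x, z⁻¹ y)`. -/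
def tensorSetoid (P Q : CircleBundle B) : Setoid (FibreProd P Q) where
  r q q' := ∃ z : Circle, q'.1 = (z • q.1.1, z⁻¹ • q.1.2)
  iseqv :=
    { refl := fun q => ⟨1, by simp⟩
      symm := by
        rintro q q' ⟨z, h⟩
        exact ⟨z⁻¹, by rw [h]; simp⟩
      trans := by
        rintro q q' q'' ⟨z, h⟩ ⟨w, h'⟩
        exact ⟨w * z, by rw [h', h]; simp [smul_smul, mul_comm]⟩ }

/-- The total space of the product bundle. -/
abbrev TensorSpace (P Q : CircleBundle B) : Type u := Quotient (tensorSetoid P Q)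

/-- The class of a pair of points in the same fibre. -/
def tmk (P Q : CircleBundle B) (q : FibreProd P Q) : TensorSpace P Q := Quotient.mk _ q

lemma tmk_surjective (P Q : CircleBundle B) : Function.Surjective (tmk P Q) :=
  Quotient.mk_surjective

lemma tmk_eq {P Q : CircleBundle B} {q q' : FibreProd P Q} :
    tmk P Q q = tmk P Q q' ↔ ∃ z : Circle, q'.1 = (z • q.1.1, z⁻¹ • q.1.2) :=
  Quotient.eq

lemma isOpenQuotientMap_tmk (P Q : CircleBundle B) : IsOpenQuotientMap (tmk P Q) := by
  refine ⟨tmk_surjective P Q, continuous_quotient_mk', ?_⟩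
  intro S hS
  change IsOpen (tmk P Q ⁻¹' (tmk P Q '' S))
  have : tmk P Q ⁻¹' (tmk P Q '' S) = ⋃ z : Circle, (fun q : FibreProd P Q =>
      (⟨(z • q.1.1, z⁻¹ • q.1.2), (P.proj_smul _ _).trans (q.2.trans (Q.proj_smul _ _).symm)⟩ :
        FibreProd P Q)) ⁻¹' S := by
    ext q
    simp only [mem_preimage, mem_image, mem_iUnion]
    constructor
    · rintro ⟨q', hq', h⟩
      obtain ⟨z, hz⟩ := tmk_eq.1 h.symm
      refine ⟨z, ?_⟩
      have e : (⟨(z • q.1.1, z⁻¹ • q.1.2), (P.proj_smul _ _).trans (q.2.trans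
        (Q.proj_smul _ _).symm)⟩ : FibreProd P Q) = q' := Subtype.ext hz.symm
      exact e ▸ hq'
    · rintro ⟨z, hz⟩
      exact ⟨_, hz, (tmk_eq.2 ⟨z, rfl⟩).symm⟩
  rw [this]
  refine isOpen_iUnion fun z => hS.preimage ?_
  fun_prop

/-- The product (contracted product over the circle group) of two principal circle bundles
over `B`: the quotient of the fibre product by `(z x, y) ∼ (x, z y)`. -/
def tensor (P Q : CircleBundle B) : CircleBundle B where
  E := TensorSpace P Q
  act z := Quotient.map
    (fun q : FibreProd P Q => ⟨(z • q.1.1, q.1.2), (P.proj_smul z q.1.1).trans q.2⟩) (by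
      rintro ⟨⟨x, y⟩, h⟩ ⟨⟨x', y'⟩, h'⟩ ⟨w, hw⟩
      obtain ⟨rfl, rfl⟩ := Prod.mk.inj hw
      exact ⟨w, Prod.ext (smul_comm _ _ _) rfl⟩)
  act_one := by
    rintro ⟨q⟩
    exact congrArg (tmk P Q) (Subtype.ext (Prod.ext (P.act_one _) rfl))
  act_mul := by
    rintro z w ⟨q⟩
    exact congrArg (tmk P Q) (Subtype.ext (Prod.ext (P.act_mul _ _ _) rfl))
  continuous_act := by
    rw [← (IsOpenQuotientMap.id.prodMap (isOpenQuotientMap_tmk P Q)).continuous_comp_iff]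
    exact (isOpenQuotientMap_tmk P Q).continuous.comp (g := tmk P Q)
      (f := fun q : Circle × FibreProd P Q => (⟨(q.1 • q.2.1.1, q.2.1.2),
        (P.proj_smul _ _).trans q.2.2⟩ : FibreProd P Q)) (by fun_prop)
  proj := Quotient.lift (fun q : FibreProd P Q => P.proj q.1.1) (by
    rintro q q' ⟨w, hw⟩
    rw [hw]
    exact (P.proj_smul _ _).symm)
  proj_act := by
    rintro z ⟨q⟩
    exact P.proj_smul _ _
  locTriv b := by
    obtain ⟨U, hU, hb, c, s, hc, hsc, hs, hcz, -⟩ := P.exists_local b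
    obtain ⟨V, hV, hb', c', s', hc', hsc', hs', hcz', -⟩ := Q.exists_local b
    have hoq := isOpenQuotientMap_tmk P Q
    have key : ∀ a : B, ∃ q : FibreProd P Q, a ∈ U ∩ V → q.1 = (s a, s' a) := by
      intro a
      by_cases h : a ∈ U ∩ V
      · exact ⟨⟨(s a, s' a), (hs a h.1).trans (hs' a h.2).symm⟩, fun _ => rfl⟩
      · exact ⟨⟨(s b, s' b), (hs b hb).trans (hs' b hb').symm⟩, fun h' => absurd h' h⟩
    choose t ht using key
    classical
    let pr : TensorSpace P Q → B := Quotient.lift (fun q : FibreProd P Q => P.proj q.1.1) (by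
      rintro q q' ⟨w, hw⟩
      rw [hw]
      exact (P.proj_smul _ _).symm)
    have hpr : Continuous pr := by
      rw [← hoq.continuous_comp_iff]
      exact P.continuous_proj.comp (by fun_prop : Continuous fun q : FibreProd P Q => q.1.1)
    let cc : TensorSpace P Q → Circle := Quotient.lift
      (fun q : FibreProd P Q => if P.proj q.1.1 ∈ U ∩ V then c q.1.1 * c' q.1.2 else 1) (by
      rintro ⟨⟨x, y⟩, h⟩ ⟨⟨x', y'⟩, h'⟩ ⟨w, hw⟩
      obtain ⟨rfl, rfl⟩ := Prod.mk.inj hw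
      have h1 : P.proj (w • x) = P.proj x := P.proj_smul _ _
      simp only [h1]
      split_ifs with hx
      · simp only at h
        rw [hcz _ _ hx.1, hcz' _ _ (h ▸ hx.2)]
        rw [mul_mul_mul_comm]; simp
      · rfl)
    refine locTriv_of (p := pr) (c := cc) (s := fun a => tmk P Q (t a)) ?_ hpr ?_ ?_
      (hU.inter hV) ⟨hb, hb'⟩ ?_ ?_ ?_ ?_
    · rw [← (IsOpenQuotientMap.id.prodMap (isOpenQuotientMap_tmk P Q)).continuous_comp_iff]
      exact (isOpenQuotientMap_tmk P Q).continuous.comp (g := tmk P Q)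
        (f := fun q : Circle × FibreProd P Q => (⟨(q.1 • q.2.1.1, q.2.1.2),
          (P.proj_smul _ _).trans q.2.2⟩ : FibreProd P Q)) (by fun_prop)
    · rintro z ⟨q⟩
      exact P.proj_smul _ _
    · rintro ⟨⟨⟨x, y⟩, h⟩⟩ ⟨⟨⟨x', y'⟩, h'⟩⟩ hxy
      change P.proj x = P.proj x' at hxy
      simp only at h h'
      obtain ⟨z, rfl⟩ := P.exists_smul hxy
      obtain ⟨w, rfl⟩ := Q.exists_smul (h.symm.trans (hxy.trans h'))
      refine ⟨w * z, tmk_eq.2 ⟨w, Prod.ext ?_ ?_⟩⟩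
      · exact P.act_mul w z x
      · change y = w⁻¹ • w • y
        simp
    · have hS : IsOpen (pr ⁻¹' (U ∩ V)) := (hU.inter hV).preimage hpr
      rw [continuousOn_iff_continuous_domRestrict,
        ← (hoq.restrictPreimage (pr ⁻¹' (U ∩ V))).continuous_comp_iff]
      have h1 : ContinuousOn (fun q : FibreProd P Q => c q.1.1 * c' q.1.2)
          (tmk P Q ⁻¹' (pr ⁻¹' (U ∩ V))) := by
        refine ContinuousOn.mul (hc.comp (by fun_prop) fun q hq => hq.1)
          (hc'.comp (by fun_prop) fun q hq => ?_)
        change Q.proj q.1.2 ∈ V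
        rw [← q.2]; exact hq.2
      refine (continuousOn_iff_continuous_domRestrict.1 h1).congr ?_
      rintro ⟨q, hq⟩
      exact (if_pos hq).symm
    · refine hoq.continuous.comp_continuousOn ?_
      refine (Topology.IsInducing.continuousOn_iff
        (Topology.IsInducing.subtypeVal (t := fun _ => _))).2 ?_
      exact ((hsc.mono inter_subset_left).prodMk (hsc'.mono inter_subset_right)).congr
        (fun a h => ht a h)
    · intro a ha
      change P.proj (t a).1.1 = a
      rw [ht a ha]
      exact hs a ha.1
    · rintro z ⟨q⟩ hq
      change P.proj q.1.1 ∈ U ∩ V at hq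
      change (if P.proj (z • q.1.1) ∈ U ∩ V then c (z • q.1.1) * c' q.1.2 else 1) =
        z * (if P.proj q.1.1 ∈ U ∩ V then c q.1.1 * c' q.1.2 else 1)
      have h1 : P.proj (z • q.1.1) = P.proj q.1.1 := P.proj_smul _ _
      rw [h1, if_pos hq, if_pos hq, hcz _ _ hq.1, mul_assoc]

lemma tensor_proj_tmk {P Q : CircleBundle B} (q : FibreProd P Q) :
    (tensor P Q).proj (tmk P Q q) = P.proj q.1.1 := rfl

lemma tensor_smul_tmk {P Q : CircleBundle B} (z : Circle) (x : P.E) (y : Q.E)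
    (h : P.proj x = Q.proj y) :
    (show (tensor P Q).E from z • (show (tensor P Q).E from tmk P Q ⟨(x, y), h⟩)) =
      tmk P Q ⟨(z • x, y), (P.proj_smul z x).trans h⟩ := rfl

lemma tmk_smul_right {P Q : CircleBundle B} (z : Circle) (x : P.E) (y : Q.E)
    (h : P.proj x = Q.proj y) :
    tmk P Q ⟨(x, z • y), h.trans (Q.proj_smul z y).symm⟩ =
      tmk P Q ⟨(z • x, y), (P.proj_smul z x).trans h⟩ :=
  tmk_eq.2 ⟨z, by simp⟩

/-- Homomorphisms out of a product bundle. -/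
def tensorHom {P Q R : CircleBundle B} (f : FibreProd P Q → R.E) (hf : Continuous f)
    (hp : ∀ q, R.proj (f q) = P.proj q.1.1)
    (hl : ∀ (z : Circle) (x : P.E) (y : Q.E) h h', f ⟨(z • x, y), h'⟩ = z • f ⟨(x, y), h⟩)
    (hr : ∀ (z : Circle) (x : P.E) (y : Q.E) h h', f ⟨(x, z • y), h'⟩ = z • f ⟨(x, y), h⟩) : Hom (tensor P Q) R where
  toFun := Quotient.lift f (by
    rintro ⟨⟨x, y⟩, h⟩ ⟨⟨x', y'⟩, h'⟩ ⟨w, hw⟩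
    obtain ⟨rfl, rfl⟩ := Prod.mk.inj hw
    have e1 := hl w x (w⁻¹ • y) (h.trans (Q.proj_smul _ _).symm) h'
    rw [hr w⁻¹ x y h _, smul_smul, mul_inv_cancel, _root_.one_smul] at e1
    exact e1.symm)
  cont := (isOpenQuotientMap_tmk P Q).continuous_comp_iff.1 hf
  proj_map := by
    rintro ⟨q⟩
    exact hp q
  map_smul := by
    rintro z ⟨⟨⟨x, y⟩, h⟩⟩
    exact hl z x y h _

/-- Functoriality of the product. -/
def tensorMap {P Q P' Q' : CircleBundle B} (f : Hom P P') (g : Hom Q Q') :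
    Hom (tensor P Q) (tensor P' Q') :=
  tensorHom (R := tensor P' Q') (fun q => tmk P' Q' ⟨(f.toFun q.1.1, g.toFun q.1.2),
      (f.proj_map _).trans (q.2.trans (g.proj_map _).symm)⟩)
    (by
      refine (isOpenQuotientMap_tmk P' Q').continuous.comp (Continuous.subtype_mk ?_ _)
      exact (f.cont.comp (by fun_prop)).prodMk (g.cont.comp (by fun_prop)))
    (fun q => f.proj_map _)
    (by
      intro z x y h h'
      simp only [f.map_smul]
      exact (tensor_smul_tmk _ _ _ _).symm)
    (by
      intro z x y h h'
      simp only [g.map_smul]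
      refine (tmk_smul_right _ _ _ ?_).trans (tensor_smul_tmk _ _ _ _).symm
      rw [f.proj_map, g.proj_map, h])

/-- Commutativity of the product. -/
def tensorComm (P Q : CircleBundle B) : Hom (tensor P Q) (tensor Q P) :=
  tensorHom (R := tensor Q P) (fun q => tmk Q P ⟨(q.1.2, q.1.1), q.2.symm⟩)
    ((isOpenQuotientMap_tmk Q P).continuous.comp (by fun_prop))
    (fun q => q.2.symm)
    (fun z x y h h' => tmk_smul_right (P := Q) (Q := P) z y x h.symm)
    (fun z x y h h' => rfl)

/-- The trivial bundle is neutral. -/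
def trivialTensor (P : CircleBundle B) : Hom (tensor (trivial B) P) P :=
  tensorHom (fun q => q.1.1.2 • q.1.2)
    ((continuous_snd.comp (by fun_prop :
      Continuous fun q : FibreProd (trivial B) P => (q.1.1 : B × Circle))).smul (by fun_prop))
    (fun q => (P.proj_smul _ _).trans q.2.symm)
    (fun z x y h h' => P.act_mul z x.2 y)
    (fun z x y h h' => smul_comm _ _ _)

lemma assoc_aux {P Q R : CircleBundle B} (q : TensorSpace P Q) (r : R.E)
    (h : (tensor P Q).proj q = R.proj r) :
    ∃ t : TensorSpace P (tensor Q R), ∀ x y h1 h2 h3, q = tmk P Q ⟨(x, y), h1⟩ →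
      t = tmk P (tensor Q R) ⟨(x, tmk Q R ⟨(y, r), h2⟩), h3⟩ := by
  obtain ⟨⟨⟨x, y⟩, h1⟩, rfl⟩ := tmk_surjective P Q q
  have h2 : Q.proj y = R.proj r := h1.symm.trans h
  refine ⟨tmk P (tensor Q R) ⟨(x, tmk Q R ⟨(y, r), h2⟩), h1⟩, ?_⟩
  intro x' y' h1' h2' h3' e
  obtain ⟨z, hz⟩ := tmk_eq.1 e
  obtain ⟨rfl, rfl⟩ := Prod.mk.inj hz
  exact tmk_eq.2 ⟨z, rfl⟩

/-- Associativity of the product. -/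
def tensorAssoc (P Q R : CircleBundle B) :
    Hom (tensor (tensor P Q) R) (tensor P (tensor Q R)) :=
  tensorHom (R := tensor P (tensor Q R))
    (fun q => (assoc_aux q.1.1 q.1.2 q.2).choose)
    (by
      have hoq := (((isOpenQuotientMap_tmk P Q).prodMap
        (IsOpenQuotientMap.id (X := R.E))).restrictPreimage
          {q : TensorSpace P Q × R.E | (tensor P Q).proj q.1 = R.proj q.2})
      refine hoq.continuous_comp_iff.1 ?_
      have hc : Continuous fun q : (Prod.map (tmk P Q) id) ⁻¹'
          {q : TensorSpace P Q × R.E | (tensor P Q).proj q.1 = R.proj q.2} =>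
          tmk P (tensor Q R) ⟨(q.1.1.1.1, tmk Q R ⟨(q.1.1.1.2, q.1.2),
            q.1.1.2.symm.trans q.2⟩), q.1.1.2⟩ := by
        refine (isOpenQuotientMap_tmk P (tensor Q R)).continuous.comp
          (Continuous.subtype_mk (Continuous.prodMk (by fun_prop) ?_) _)
        exact (isOpenQuotientMap_tmk Q R).continuous.comp (by fun_prop)
      refine hc.congr ?_
      rintro ⟨⟨q, r⟩, h⟩
      exact ((assoc_aux (tmk P Q q) r h).choose_spec _ _ _ _ _ rfl).symm)
    (by
      rintro ⟨⟨q, r⟩, h⟩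
      obtain ⟨⟨⟨x, y⟩, h1⟩, rfl⟩ := tmk_surjective P Q q
      have h2 : Q.proj y = R.proj r := h1.symm.trans h
      simp only
      rw [(assoc_aux (tmk P Q ⟨(x, y), h1⟩) r h).choose_spec x y h1 h2 h1 rfl]
      rfl)
    (by
      intro z q r h h'
      obtain ⟨⟨⟨x, y⟩, h1⟩, rfl⟩ := tmk_surjective P Q q
      have h2 : Q.proj y = R.proj r := h1.symm.trans h
      simp only
      rw [(assoc_aux (tmk P Q ⟨(x, y), h1⟩) r h).choose_spec x y h1 h2 h1 rfl,
        (assoc_aux _ r h').choose_spec (z • x) y ((P.proj_smul _ _).trans h1) h2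
          ((P.proj_smul _ _).trans h1) rfl]
      rfl)
    (by
      intro z q r h h'
      obtain ⟨⟨⟨x, y⟩, h1⟩, rfl⟩ := tmk_surjective P Q q
      have h2 : Q.proj y = R.proj r := h1.symm.trans h
      simp only
      rw [(assoc_aux (tmk P Q ⟨(x, y), h1⟩) r h).choose_spec x y h1 h2 h1 rfl,
        (assoc_aux _ (z • r) h').choose_spec x y h1 (h2.trans (R.proj_smul _ _).symm) h1 rfl]
      have e : tmk Q R ⟨(y, z • r), h2.trans (R.proj_smul _ _).symm⟩ =
        (show (tensor Q R).E from z • (show (tensor Q R).E from tmk Q R ⟨(y, r), h2⟩)) :=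
        tmk_smul_right z y r h2
      simp only [e]
      exact tmk_smul_right (P := P) (Q := tensor Q R) z x (tmk Q R ⟨(y, r), h2⟩) h1)

lemma tensorAssoc_apply {P Q R : CircleBundle B} (x : P.E) (y : Q.E) (r : R.E)
    (h1 : P.proj x = Q.proj y) (h2 : Q.proj y = R.proj r) :
    (tensorAssoc P Q R).toFun (tmk (tensor P Q) R ⟨(tmk P Q ⟨(x, y), h1⟩, r), h1.trans h2⟩) =
      tmk P (tensor Q R) ⟨(x, tmk Q R ⟨(y, r), h2⟩), h1⟩ :=
  (assoc_aux (tmk P Q ⟨(x, y), h1⟩) r (h1.trans h2)).choose_spec x y h1 h2 h1 rfl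

/-- The ratio `y / x` of two points in the same fibre: the scalar `z` with `y = z • x`. -/
def ratio (P : CircleBundle B) (x y : P.E) (h : P.proj x = P.proj y) : Circle :=
  (P.exists_smul h).choose

lemma ratio_eq {P : CircleBundle B} {x y : P.E} (h : P.proj x = P.proj y) {z : Circle}
    (hz : y = z • x) : P.ratio x y h = z :=
  P.smul_inj (x := x) ((P.exists_smul h).choose_spec.symm.trans hz)

lemma ratio_smul_left {P : CircleBundle B} {x y : P.E} (h : P.proj x = P.proj y) (z : Circle)
    (h' : P.proj (z⁻¹ • x) = P.proj y) : P.ratio (z⁻¹ • x) y h' = z * P.ratio x y h := by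
  obtain ⟨w, rfl⟩ := P.exists_smul h
  rw [ratio_eq h rfl]
  refine ratio_eq h' ?_
  rw [smul_smul, mul_comm z w]; simp

lemma ratio_smul_right {P : CircleBundle B} {x y : P.E} (h : P.proj x = P.proj y) (z : Circle)
    (h' : P.proj x = P.proj (z • y)) : P.ratio x (z • y) h' = z * P.ratio x y h := by
  obtain ⟨w, rfl⟩ := P.exists_smul h
  rw [ratio_eq h rfl]
  exact ratio_eq h' (smul_smul _ _ _)

lemma continuous_ratio (P : CircleBundle B) :
    Continuous fun q : {q : P.E × P.E // P.proj q.1 = P.proj q.2} => P.ratio q.1.1 q.1.2 q.2 := by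
  rw [continuous_iff_continuousAt]
  rintro ⟨⟨x, y⟩, h⟩
  obtain ⟨U, hU, hb, c, s, hc, -, -, hcz, -⟩ := P.exists_local (P.proj x)
  have hV : IsOpen (P.proj ⁻¹' U) := hU.preimage P.continuous_proj
  have h1 : ContinuousOn (fun q : {q : P.E × P.E // P.proj q.1 = P.proj q.2} =>
      c q.1.2 / c q.1.1) {q | P.proj q.1.1 ∈ U} := by
    refine ContinuousOn.div' (hc.comp (by fun_prop) ?_) (hc.comp (by fun_prop) fun q h => h)
    intro q hq
    change P.proj q.1.2 ∈ U
    rw [← q.2]; exact hq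
  have hn : {q : {q : P.E × P.E // P.proj q.1 = P.proj q.2} | P.proj q.1.1 ∈ U} ∈
      𝓝 ⟨(x, y), h⟩ :=
    (hV.preimage (f := fun q : {q : P.E × P.E // P.proj q.1 = P.proj q.2} => q.1.1)
      (by fun_prop)).mem_nhds hb
  refine (h1.continuousAt hn).congr ?_
  filter_upwards [hn] with q hq
  obtain ⟨⟨x', y'⟩, h'⟩ := q
  have h0 : P.proj x' = P.proj y' := h'
  obtain ⟨z, rfl⟩ := P.exists_smul h0
  simp only
  rw [ratio_eq h' rfl, hcz _ _ hq]
  simp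

/-- The conjugate bundle is inverse to a bundle. -/
def conjTensor (P : CircleBundle B) : Hom (tensor (conj P) P) (trivial B) :=
  tensorHom (P := conj P) (Q := P) (R := trivial B)
    (fun q => (P.proj q.1.1, P.ratio q.1.1 q.1.2 q.2))
    (by
      change Continuous fun q : {q : P.E × P.E // P.proj q.1 = P.proj q.2} =>
        (P.proj q.1.1, P.ratio q.1.1 q.1.2 q.2)
      exact (P.continuous_proj.comp (continuous_fst.comp continuous_subtype_val)).prodMk
        P.continuous_ratio)
    (fun q => rfl)
    (fun z x y h h' => Prod.ext (P.proj_smul z⁻¹ x) (ratio_smul_left (P := P) h z h'))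
    (fun z x y h h' => Prod.ext rfl (ratio_smul_right (P := P) h z h'))

/-- Functoriality of conjugation. -/
def conjMap {P Q : CircleBundle B} (f : Hom P Q) : Hom (conj P) (conj Q) where
  toFun := f.toFun
  cont := f.cont
  proj_map := f.proj_map
  map_smul z x := f.map_smul z⁻¹ x

/-- Isomorphism of principal circle bundles as an equivalence relation. -/
instance isoSetoid (B : Type u) [TopologicalSpace B] : Setoid (CircleBundle B) where
  r P Q := Nonempty (Iso P Q)
  iseqv :=
    { refl := fun P => ⟨(Hom.id P).iso⟩
      symm := fun ⟨f⟩ => ⟨f.inv.iso⟩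
      trans := fun ⟨f⟩ ⟨g⟩ => ⟨(g.hom.comp f.hom).iso⟩ }

end CircleBundle

/-- The group `H¹(B, 𝒮)`, realized as the set of isomorphism classes of principal circle bundles
over `B`. -/
def H1 (B : Type u) [TopologicalSpace B] : Type (u + 1) := Quotient (CircleBundle.isoSetoid B)

/-- The isomorphism class of a principal circle bundle. -/
def CircleBundle.cls {B : Type u} [TopologicalSpace B] (P : CircleBundle B) : H1 B :=
  Quotient.mk _ P

/-- The group structure on isomorphism classes of principal circle bundles: the product is the
contracted product, the inverse is the conjugate bundle. -/
instance (B : Type u) [TopologicalSpace B] : CommGroup (H1 B) where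
  mul := Quotient.map₂ CircleBundle.tensor
    (fun _ _ ⟨f⟩ _ _ ⟨g⟩ => ⟨(CircleBundle.tensorMap f.hom g.hom).iso⟩)
  one := (CircleBundle.trivial B).cls
  inv := Quotient.map CircleBundle.conj (fun _ _ ⟨f⟩ => ⟨(CircleBundle.conjMap f.hom).iso⟩)
  mul_assoc := by
    rintro ⟨P⟩ ⟨Q⟩ ⟨R⟩
    exact Quotient.sound ⟨(CircleBundle.tensorAssoc P Q R).iso⟩
  one_mul := by
    rintro ⟨P⟩
    exact Quotient.sound ⟨(CircleBundle.trivialTensor P).iso⟩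
  mul_one := by
    rintro ⟨P⟩
    exact Quotient.sound ⟨((CircleBundle.trivialTensor P).comp
      (CircleBundle.tensorComm P (CircleBundle.trivial B))).iso⟩
  inv_mul_cancel := by
    rintro ⟨P⟩
    exact Quotient.sound ⟨(CircleBundle.conjTensor P).iso⟩
  mul_comm := by
    rintro ⟨P⟩ ⟨Q⟩
    exact Quotient.sound ⟨(CircleBundle.tensorComm P Q).iso⟩
/-! ## The groupoid of a local homeomorphism -/

variable {X : Type u}

/-- The groupoid `Γ(X, σ)`: triples `(x, k - l, y)` with `σ^k x = σ^l y`. -/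
@[ext]
structure Gpd (σ : X → X) : Type u where
  r : X
  c : ℤ
  s : X
  mem : ∃ k l : ℕ, σ^[k] r = σ^[l] s ∧ (k : ℤ) - l = c

namespace Gpd

variable {σ : X → X}

/-- The set `X_{k,l}` of all `(x, k - l, y)` with `σ^k x = σ^l y`. -/
def layer (σ : X → X) (k l : ℕ) : Set (Gpd σ) :=
  {γ | σ^[k] γ.r = σ^[l] γ.s ∧ (k : ℤ) - l = γ.c}

/-- The units `(x, 0, x)`. -/
def unit (σ : X → X) (x : X) : Gpd σ := ⟨x, 0, x, 0, 0, rfl, by simp⟩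

lemma mul_mem_layer {a b : Gpd σ} (h : a.s = b.r) {k l k' l' : ℕ} (ha : a ∈ layer σ k l)
    (hb : b ∈ layer σ k' l') :
    σ^[k + k'] a.r = σ^[l + l'] b.s ∧ ((k + k' : ℕ) : ℤ) - (l + l' : ℕ) = a.c + b.c := by
  obtain ⟨h1, h2⟩ := ha
  obtain ⟨h3, h4⟩ := hb
  constructor
  · rw [add_comm k k', Function.iterate_add_apply, h1, h, ← Function.iterate_add_apply,
      add_comm k' l, Function.iterate_add_apply, h3, ← Function.iterate_add_apply]
  · push_cast
    linarith

/-- The product `(x, m, y)(y, n, z) = (x, m + n, z)`. -/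
def mul (a b : Gpd σ) (h : a.s = b.r) : Gpd σ :=
  ⟨a.r, a.c + b.c, b.s, by
    obtain ⟨k, l, h1⟩ := a.mem
    obtain ⟨k', l', h2⟩ := b.mem
    exact ⟨k + k', l + l', mul_mem_layer h h1 h2⟩⟩

/-- The inverse `(x, m, y)⁻¹ = (y, -m, x)`. -/
def inv (a : Gpd σ) : Gpd σ :=
  ⟨a.s, -a.c, a.r, by
    obtain ⟨k, l, h1, h2⟩ := a.mem
    exact ⟨l, k, h1.symm, by rw [← h2]; ring⟩⟩

/-- The map `j(x) = (x, 1, σ x)`. -/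
def j (σ : X → X) (x : X) : Gpd σ := ⟨x, 1, σ x, 1, 0, rfl, by simp⟩

variable [TopologicalSpace X]

/-- The topology of `Γ(X, σ)`: a basis is given by the sets
`{(x, k - l, y) | x ∈ U, y ∈ V, σ^k x = σ^l y}` for `U`, `V` open in `X`. -/
instance : TopologicalSpace (Gpd σ) :=
  TopologicalSpace.generateFrom {S | ∃ (k l : ℕ) (U V : Set X), IsOpen U ∧ IsOpen V ∧
    S = {γ | γ ∈ layer σ k l ∧ γ.r ∈ U ∧ γ.s ∈ V}}

lemma isOpen_basic (k l : ℕ) {U V : Set X} (hU : IsOpen U) (hV : IsOpen V) :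
    IsOpen {γ : Gpd σ | γ ∈ layer σ k l ∧ γ.r ∈ U ∧ γ.s ∈ V} :=
  TopologicalSpace.isOpen_generateFrom_of_mem ⟨k, l, U, V, hU, hV, rfl⟩

lemma isOpen_layer (k l : ℕ) : IsOpen (layer σ k l) := by
  simpa using isOpen_basic (σ := σ) k l isOpen_univ isOpen_univ

lemma continuous_r : Continuous (r : Gpd σ → X) := by
  refine ⟨fun U hU => ?_⟩
  have : (r : Gpd σ → X) ⁻¹' U =
      ⋃ (k : ℕ) (l : ℕ), {γ | γ ∈ layer σ k l ∧ γ.r ∈ U ∧ γ.s ∈ univ} := by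
    ext γ
    obtain ⟨k, l, h⟩ := γ.mem
    simp only [mem_preimage, mem_iUnion, mem_ofPred_eq]
    exact ⟨fun h' => ⟨k, l, h, h', mem_univ _⟩, fun ⟨_, _, _, h', _⟩ => h'⟩
  rw [this]
  exact isOpen_iUnion fun k => isOpen_iUnion fun l => isOpen_basic k l hU isOpen_univ

lemma continuous_s : Continuous (s : Gpd σ → X) := by
  refine ⟨fun U hU => ?_⟩
  have : (s : Gpd σ → X) ⁻¹' U =
      ⋃ (k : ℕ) (l : ℕ), {γ | γ ∈ layer σ k l ∧ γ.r ∈ univ ∧ γ.s ∈ U} := by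
    ext γ
    obtain ⟨k, l, h⟩ := γ.mem
    simp only [mem_preimage, mem_iUnion, mem_ofPred_eq]
    exact ⟨fun h' => ⟨k, l, h, mem_univ _, h'⟩, fun ⟨_, _, _, _, h'⟩ => h'⟩
  rw [this]
  exact isOpen_iUnion fun k => isOpen_iUnion fun l => isOpen_basic k l isOpen_univ hU

lemma isLocalHomeomorph_iterate (hσ : IsLocalHomeomorph σ) (n : ℕ) :
    IsLocalHomeomorph σ^[n] := by
  induction n with
  | zero => exact (Homeomorph.refl X).isLocalHomeomorph
  | succ n ih => exact ih.comp hσ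

/-- A map into `Γ` is continuous at a point if its two end points are and it stays in one of the
sets `X_{k,l}` near the point. -/
lemma continuousAt_of (hσ : IsLocalHomeomorph σ) {Y : Type*} [TopologicalSpace Y] {f : Y → Gpd σ}
    {y : Y} (hr : ContinuousAt (fun y => (f y).r) y) (hs : ContinuousAt (fun y => (f y).s) y)
    {k l : ℕ} (hl : ∀ᶠ y' in 𝓝 y, f y' ∈ layer σ k l) : ContinuousAt f y := by
  refine TopologicalSpace.tendsto_nhds_generateFrom_iff.2 ?_
  rintro S ⟨k', l', U, V, hU, hV, rfl⟩ ⟨hy, hyU, hyV⟩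
  have h0 := hl.self_of_nhds
  have key : ∀ᶠ y' in 𝓝 y, f y' ∈ layer σ k' l' := by
    have hkl : (k : ℤ) - l = k' - l' := h0.2.trans hy.2.symm
    rcases le_total k k' with hk | hk
    · obtain ⟨n, rfl⟩ := Nat.exists_eq_add_of_le' hk
      obtain rfl : l' = n + l := by omega
      filter_upwards [hl] with y' hy'
      refine ⟨?_, ?_⟩
      · rw [Function.iterate_add_apply, hy'.1, ← Function.iterate_add_apply]
      · rw [← hy'.2, hkl]
    · obtain ⟨n, rfl⟩ := Nat.exists_eq_add_of_le' hk
      obtain rfl : l = n + l' := by omega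
      obtain ⟨W, hW, hyW, hinj⟩ := (isLocalHomeomorph_iterate hσ n).isLocallyInjective
        (σ^[k'] (f y).r)
      have c1 : ∀ᶠ y' in 𝓝 y, σ^[k'] (f y').r ∈ W :=
        ((isLocalHomeomorph_iterate hσ k').continuous.continuousAt.comp hr).eventually
          (hW.mem_nhds hyW)
      have c2 : ∀ᶠ y' in 𝓝 y, σ^[l'] (f y').s ∈ W :=
        ((isLocalHomeomorph_iterate hσ l').continuous.continuousAt.comp hs).eventually
          (hW.mem_nhds (by
            change σ^[l'] (f y).s ∈ W
            rw [← hy.1]; exact hyW))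
      filter_upwards [hl, c1, c2] with y' h1 h2 h3
      refine ⟨hinj h2 h3 ?_, ?_⟩
      · rw [← Function.iterate_add_apply, h1.1, Function.iterate_add_apply]
      · rw [← h1.2, hkl]
  filter_upwards [key, hr.eventually (hU.mem_nhds hyU), hs.eventually (hV.mem_nhds hyV)]
    with y' h1 h2 h3 using ⟨h1, h2, h3⟩

lemma continuous_unit (hσ : IsLocalHomeomorph σ) : Continuous (unit σ) :=
  continuous_iff_continuousAt.2 fun _ => continuousAt_of hσ (k := 0) (l := 0)
    continuous_id.continuousAt continuous_id.continuousAt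
    (Eventually.of_forall fun _ => ⟨rfl, by simp [unit]⟩)

lemma continuous_j (hσ : IsLocalHomeomorph σ) : Continuous (j σ) :=
  continuous_iff_continuousAt.2 fun _ => continuousAt_of hσ (k := 1) (l := 0)
    continuous_id.continuousAt hσ.continuous.continuousAt
    (Eventually.of_forall fun _ => ⟨rfl, by simp [j]⟩)

lemma continuous_inv (hσ : IsLocalHomeomorph σ) : Continuous (inv : Gpd σ → Gpd σ) := by
  rw [continuous_iff_continuousAt]
  intro γ
  obtain ⟨k, l, h⟩ := γ.mem
  refine continuousAt_of hσ (k := l) (l := k) continuous_s.continuousAt continuous_r.continuousAt ?_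
  filter_upwards [(isOpen_layer k l).mem_nhds h] with γ' h'
  exact ⟨h'.1.symm, by change (l : ℤ) - k = -γ'.c; rw [← h'.2]; ring⟩

lemma continuous_mul (hσ : IsLocalHomeomorph σ) :
    Continuous fun q : {q : Gpd σ × Gpd σ // q.1.s = q.2.r} => mul q.1.1 q.1.2 q.2 := by
  rw [continuous_iff_continuousAt]
  rintro ⟨⟨a, b⟩, h⟩
  obtain ⟨k, l, ha⟩ := a.mem
  obtain ⟨k', l', hb⟩ := b.mem
  have p1 : Continuous fun q : {q : Gpd σ × Gpd σ // q.1.s = q.2.r} => q.1.1 := by fun_prop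
  have p2 : Continuous fun q : {q : Gpd σ × Gpd σ // q.1.s = q.2.r} => q.1.2 := by fun_prop
  refine continuousAt_of hσ (k := k + k') (l := l + l') (continuous_r.comp p1).continuousAt
    (continuous_s.comp p2).continuousAt ?_
  filter_upwards [p1.continuousAt.eventually ((isOpen_layer k l).mem_nhds ha),
    p2.continuousAt.eventually ((isOpen_layer k' l').mem_nhds hb)] with q h1 h2
  exact mul_mem_layer q.2 h1 h2

end Gpd

/-! ## Twists -/

variable [TopologicalSpace X] {σ : X → X}

/-- A (circle) twist over `Γ(X, σ)`: a principal circle bundle over `Γ(X, σ)` whose total space is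
a topological groupoid with unit space `X`, such that the bundle projection is a groupoid
homomorphism (which is the identity on units) and the circle action is compatible with the
multiplication. -/
structure Twist (σ : X → X) extends CircleBundle (Gpd σ) where
  mul : ∀ a b : E, (proj a).s = (proj b).r → E
  one : X → E
  inv : E → E
  proj_mul : ∀ a b h, proj (mul a b h) = (proj a).mul (proj b) h
  proj_one : ∀ x, proj (one x) = Gpd.unit σ x
  proj_inv : ∀ a, proj (inv a) = (proj a).inv
  mul_assoc : ∀ a b c h₁ h₂ h₃ h₄, mul (mul a b h₁) c h₂ = mul a (mul b c h₃) h₄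
  one_mul : ∀ a h, mul (one (proj a).r) a h = a
  mul_one : ∀ a h, mul a (one (proj a).s) h = a
  inv_mul : ∀ a h, mul (inv a) a h = one (proj a).s
  mul_inv : ∀ a h, mul a (inv a) h = one (proj a).r
  act_mul_act : ∀ z w a b h h', mul (act z a) (act w b) h' = act (z * w) (mul a b h)
  continuous_mul : Continuous fun q : {q : E × E // (proj q.1).s = (proj q.2).r} =>
    mul q.1.1 q.1.2 q.2
  continuous_one : Continuous one
  continuous_inv : Continuous inv

namespace Twist

/-- Isomorphism of twists: an isomorphism of circle bundles over `Γ(X, σ)` (a homeomorphism that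
is equivariant and covers the identity of `Γ(X, σ)`) that is multiplicative. -/
structure Iso (Λ Μ : Twist σ) : Type u extends
    CircleBundle.Iso Λ.toCircleBundle Μ.toCircleBundle where
  map_mul : ∀ a b h h', toFun (Λ.mul a b h) = Μ.mul (toFun a) (toFun b) h'

/-- A multiplicative bundle homomorphism is an isomorphism of twists. -/
def isoOfHom {Λ Μ : Twist σ} (f : CircleBundle.Hom Λ.toCircleBundle Μ.toCircleBundle)
    (hf : ∀ a b h h', f.toFun (Λ.mul a b h) = Μ.mul (f.toFun a) (f.toFun b) h') : Iso Λ Μ :=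
  { f.iso with map_mul := hf }

lemma mul_congr (Λ : Twist σ) {a a' b b' : Λ.E} (h : (Λ.proj a).s = (Λ.proj b).r)
    (ha : a = a') (hb : b = b') (h' : (Λ.proj a').s = (Λ.proj b').r) :
    Λ.mul a b h = Λ.mul a' b' h' := by
  subst ha hb; rfl

lemma s_inv_eq (Λ : Twist σ) (a : Λ.E) : (Λ.proj (Λ.inv a)).s = (Λ.proj a).r := by
  rw [Λ.proj_inv]; rfl

lemma r_inv_eq (Λ : Twist σ) (a : Λ.E) : (Λ.proj a).s = (Λ.proj (Λ.inv a)).r := by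
  rw [Λ.proj_inv]; rfl

lemma s_one_eq (Λ : Twist σ) (x : X) : (Λ.proj (Λ.one x)).s = x := by
  rw [Λ.proj_one]; rfl

lemma r_one_eq (Λ : Twist σ) (x : X) : (Λ.proj (Λ.one x)).r = x := by
  rw [Λ.proj_one]; rfl

lemma eq_inv_of_mul (Λ : Twist σ) {a b : Λ.E}
    (h : (Λ.proj b).s = (Λ.proj a).r)
    (e : Λ.mul b a h = Λ.one (Λ.proj a).s) : b = Λ.inv a := by
  have h3 := Λ.r_inv_eq a
  have e1 : Λ.mul b (Λ.one (Λ.proj b).s) (Λ.r_one_eq _).symm = b := Λ.mul_one b _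
  have e2 : Λ.one (Λ.proj b).s = Λ.mul a (Λ.inv a) h3 := by rw [Λ.mul_inv, h]
  have h4 : (Λ.proj b).s = (Λ.proj (Λ.mul a (Λ.inv a) h3)).r := by rw [Λ.proj_mul]; exact h
  have h5 : (Λ.proj (Λ.mul b a h)).s = (Λ.proj (Λ.inv a)).r := by rw [Λ.proj_mul]; exact h3
  have h6 : (Λ.proj (Λ.one (Λ.proj (Λ.inv a)).r)).s = (Λ.proj (Λ.inv a)).r := Λ.s_one_eq _
  rw [← e1, Λ.mul_congr _ rfl e2 h4, ← Λ.mul_assoc b a (Λ.inv a) h h5 h3 h4,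
    Λ.mul_congr h5 (e.trans (by rw [← h3])) rfl h6]
  exact Λ.one_mul _ _

lemma inv_smul (Λ : Twist σ) (z : Circle) (a : Λ.E) : Λ.inv (z • a) = z⁻¹ • Λ.inv a := by
  have hp : Λ.proj (z • a) = Λ.proj a := Λ.proj_act z a
  have hp' : Λ.proj (z⁻¹ • Λ.inv a) = Λ.proj (Λ.inv a) := Λ.proj_act _ _
  symm
  refine Λ.eq_inv_of_mul ?_ ?_
  · rw [hp, hp', Λ.s_inv_eq]
  · refine (Λ.act_mul_act _ _ _ _ (Λ.s_inv_eq a) _).trans ?_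
    rw [Λ.inv_mul, inv_mul_cancel, hp]
    exact Λ.act_one _

lemma Iso.hom_mul {Λ Μ : Twist σ} (f : Iso Λ Μ) (a b : Λ.E) (h h') :
    f.toIso.hom.toFun (Λ.mul a b h) = Μ.mul (f.toIso.hom.toFun a) (f.toIso.hom.toFun b) h' :=
  f.map_mul a b h h'

/-- The trivial twist `Γ × Circle`. -/
def trivial (hσ : IsLocalHomeomorph σ) : Twist σ where
  toCircleBundle := CircleBundle.trivial (Gpd σ)
  mul a b h := (a.1.mul b.1 h, a.2 * b.2)
  one x := (Gpd.unit σ x, 1)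
  inv a := (a.1.inv, a.2⁻¹)
  proj_mul _ _ _ := rfl
  proj_one _ := rfl
  proj_inv _ := rfl
  mul_assoc a b c _ _ _ _ := Prod.ext (Gpd.ext rfl (add_assoc _ _ _) rfl) (_root_.mul_assoc _ _ _)
  one_mul a _ := Prod.ext (Gpd.ext rfl (zero_add _) rfl) (_root_.one_mul _)
  mul_one a _ := Prod.ext (Gpd.ext rfl (add_zero _) rfl) (_root_.mul_one _)
  inv_mul a _ := Prod.ext (Gpd.ext rfl (neg_add_cancel _) rfl) (inv_mul_cancel _)
  mul_inv a _ := Prod.ext (Gpd.ext rfl (add_neg_cancel _) rfl) (mul_inv_cancel _)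
  act_mul_act z w a b h h' := Prod.ext rfl (mul_mul_mul_comm z a.2 w b.2)
  continuous_mul := by
    refine Continuous.prodMk ?_ ?_
    · exact (Gpd.continuous_mul hσ).comp
        (f := fun q : {q : (Gpd σ × Circle) × (Gpd σ × Circle) // q.1.1.s = q.2.1.r} =>
          (⟨(q.1.1.1, q.1.2.1), q.2⟩ : {q : Gpd σ × Gpd σ // q.1.s = q.2.r})) (by fun_prop)
    · change Continuous fun q : {q : (Gpd σ × Circle) × (Gpd σ × Circle) // q.1.1.s = q.2.1.r} =>
        q.1.1.2 * q.1.2.2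
      fun_prop
  continuous_one := (Gpd.continuous_unit hσ).prodMk continuous_const
  continuous_inv := by
    change Continuous fun a : Gpd σ × Circle => (a.1.inv, a.2⁻¹)
    exact ((Gpd.continuous_inv hσ).comp continuous_fst).prodMk continuous_snd.inv

/-- The conjugate twist: the same groupoid, with `z` acting as `z⁻¹`. -/
def conj (Λ : Twist σ) : Twist σ where
  toCircleBundle := Λ.toCircleBundle.conj
  mul := Λ.mul
  one := Λ.one
  inv := Λ.inv
  proj_mul := Λ.proj_mul
  proj_one := Λ.proj_one
  proj_inv := Λ.proj_inv
  mul_assoc := Λ.mul_assoc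
  one_mul := Λ.one_mul
  mul_one := Λ.mul_one
  inv_mul := Λ.inv_mul
  mul_inv := Λ.mul_inv
  act_mul_act z w a b h h' := by
    refine (Λ.act_mul_act z⁻¹ w⁻¹ a b h h').trans ?_
    change Λ.act _ _ = Λ.act (z * w)⁻¹ _
    rw [_root_.mul_inv]
  continuous_mul := Λ.continuous_mul
  continuous_one := Λ.continuous_one
  continuous_inv := Λ.continuous_inv

section Baer

open CircleBundle

variable {Λ Μ : Twist σ}

local notation "pr" => CircleBundle.proj (CircleBundle.tensor (toCircleBundle Λ) (toCircleBundle Μ))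

lemma mul_compat (a a' : Λ.E) (b b' : Μ.E) (h : Λ.proj a = Μ.proj b) (h' : Λ.proj a' = Μ.proj b')
    (e : (Λ.proj a).s = (Λ.proj a').r) (e' : (Μ.proj b).s = (Μ.proj b').r) :
    Λ.proj (Λ.mul a a' e) = Μ.proj (Μ.mul b b' e') := by
  rw [Λ.proj_mul, Μ.proj_mul]
  simp only [h, h']

lemma tensor_mul_aux (p q : TensorSpace Λ.toCircleBundle Μ.toCircleBundle)
    (hpq : (pr p).s = (pr q).r) :
    ∃ t : TensorSpace Λ.toCircleBundle Μ.toCircleBundle, ∀ a b a' b' h h' e e' e'',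
      p = tmk _ _ ⟨(a, b), h⟩ → q = tmk _ _ ⟨(a', b'), h'⟩ →
      t = tmk Λ.toCircleBundle Μ.toCircleBundle ⟨(Λ.mul a a' e, Μ.mul b b' e'), e''⟩ := by
  obtain ⟨⟨⟨a, b⟩, h⟩, rfl⟩ := tmk_surjective _ _ p
  obtain ⟨⟨⟨a', b'⟩, h'⟩, rfl⟩ := tmk_surjective _ _ q
  have e : (Λ.proj a).s = (Λ.proj a').r := hpq
  have e' : (Μ.proj b).s = (Μ.proj b').r := by
    have h1 : Λ.proj a = Μ.proj b := h
    have h2 : Λ.proj a' = Μ.proj b' := h'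
    rw [← h1, ← h2]; exact e
  refine ⟨tmk _ _ ⟨(Λ.mul a a' e, Μ.mul b b' e'), mul_compat a a' b b' h h' e e'⟩, ?_⟩
  intro a₁ b₁ a₁' b₁' h₁ h₁' e₁ e₁' e₁'' E E'
  obtain ⟨z, hz⟩ := tmk_eq.1 E
  obtain ⟨w, hw⟩ := tmk_eq.1 E'
  obtain ⟨rfl, rfl⟩ := Prod.mk.inj hz
  obtain ⟨rfl, rfl⟩ := Prod.mk.inj hw
  refine tmk_eq.2 ⟨z * w, Prod.ext (Λ.act_mul_act z w a a' e e₁) ?_⟩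
  refine (Μ.act_mul_act z⁻¹ w⁻¹ b b' e' e₁').trans ?_
  change Μ.act _ _ = Μ.act (z * w)⁻¹ _
  rw [_root_.mul_inv]

/-- The product in the Baer sum of two twists: `[a, b] [a', b'] = [a a', b b']`. -/
def tensorMul (p q : TensorSpace Λ.toCircleBundle Μ.toCircleBundle)
    (hpq : (pr p).s = (pr q).r) : TensorSpace Λ.toCircleBundle Μ.toCircleBundle :=
  (tensor_mul_aux p q hpq).choose

lemma tensorMul_tmk (a a' : Λ.E) (b b' : Μ.E) (h : Λ.proj a = Μ.proj b)
    (h' : Λ.proj a' = Μ.proj b') (e : (Λ.proj a).s = (Λ.proj a').r)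
    (e' : (Μ.proj b).s = (Μ.proj b').r) (e'') :
    tensorMul (tmk Λ.toCircleBundle Μ.toCircleBundle ⟨(a, b), h⟩) (tmk _ _ ⟨(a', b'), h'⟩) e'' =
      tmk Λ.toCircleBundle Μ.toCircleBundle ⟨(Λ.mul a a' e, Μ.mul b b' e'),
        mul_compat a a' b b' h h' e e'⟩ :=
  (tensor_mul_aux _ _ e'').choose_spec a b a' b' h h' e e' _ rfl rfl

end Baer

open CircleBundle in
/-- The Baer sum of two twists: the product circle bundle over `Γ(X, σ)` (pairs over the same point,
modulo `(z a, b) ∼ (a, z b)`), with the groupoid operations `[a, b] [a', b'] = [a a', b b']` and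
`[a, b]⁻¹ = [a⁻¹, b⁻¹]`. -/
def baer (Λ Μ : Twist σ) : Twist σ where
  toCircleBundle := Λ.toCircleBundle.tensor Μ.toCircleBundle
  mul := tensorMul
  one x := tmk Λ.toCircleBundle Μ.toCircleBundle
    ⟨(Λ.one x, Μ.one x), (Λ.proj_one x).trans (Μ.proj_one x).symm⟩
  inv := Quotient.map (fun q => ⟨(Λ.inv q.1.1, Μ.inv q.1.2),
    (Λ.proj_inv _).trans ((congrArg Gpd.inv q.2).trans (Μ.proj_inv _).symm)⟩) (by
      rintro ⟨⟨a, b⟩, h⟩ ⟨⟨a', b'⟩, h'⟩ ⟨z, hz⟩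
      obtain ⟨rfl, rfl⟩ := Prod.mk.inj hz
      exact ⟨z⁻¹, Prod.ext (Λ.inv_smul z a) (Μ.inv_smul z⁻¹ b)⟩)
  proj_mul := by
    rintro ⟨⟨⟨a, b⟩, h⟩⟩ ⟨⟨⟨a', b'⟩, h'⟩⟩ e
    have e0 : (Λ.proj a).s = (Λ.proj a').r := e
    have e' : (Μ.proj b).s = (Μ.proj b').r := by
      rw [← (show Λ.proj a = Μ.proj b from h), ← (show Λ.proj a' = Μ.proj b' from h')]; exact e
    refine (congrArg _ (tensorMul_tmk a a' b b' h h' e0 e' e)).trans ?_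
    exact Λ.proj_mul a a' e0
  proj_one x := Λ.proj_one x
  proj_inv := by
    rintro ⟨⟨⟨a, b⟩, h⟩⟩
    exact Λ.proj_inv a
  mul_assoc := by
    rintro ⟨⟨⟨a, b⟩, h⟩⟩ ⟨⟨⟨a', b'⟩, h'⟩⟩ ⟨⟨⟨a'', b''⟩, h''⟩⟩ h₁ h₂ h₃ h₄
    have k : Λ.proj a = Μ.proj b := h
    have k' : Λ.proj a' = Μ.proj b' := h'
    have k'' : Λ.proj a'' = Μ.proj b'' := h''
    have e1 : (Λ.proj a).s = (Λ.proj a').r := h₁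
    have e2 : (Λ.proj a').s = (Λ.proj a'').r := h₃
    have f1 : (Μ.proj b).s = (Μ.proj b').r := by rw [← k, ← k']; exact e1
    have f2 : (Μ.proj b').s = (Μ.proj b'').r := by rw [← k', ← k'']; exact e2
    have e3 : (Λ.proj (Λ.mul a a' e1)).s = (Λ.proj a'').r := by rw [Λ.proj_mul]; exact e2
    have f3 : (Μ.proj (Μ.mul b b' f1)).s = (Μ.proj b'').r := by rw [Μ.proj_mul]; exact f2
    have e4 : (Λ.proj a).s = (Λ.proj (Λ.mul a' a'' e2)).r := by rw [Λ.proj_mul]; exact e1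
    have f4 : (Μ.proj b).s = (Μ.proj (Μ.mul b' b'' f2)).r := by rw [Μ.proj_mul]; exact f1
    have A := tensorMul_tmk a a' b b' k k' e1 f1 h₁
    have A' := tensorMul_tmk a' a'' b' b'' k' k'' e2 f2 h₃
    have C : ∀ p p' q q' : TensorSpace Λ.toCircleBundle Μ.toCircleBundle, p = p' → q = q' →
        ∀ u v, tensorMul p q u = tensorMul p' q' v := by
      rintro p _ q _ rfl rfl u v; rfl
    refine (C _ _ _ _ A rfl h₂ e3).trans ?_
    refine Eq.trans ?_ (C _ _ _ _ rfl A' h₄ e4).symm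
    refine (tensorMul_tmk _ _ _ _ (mul_compat a a' b b' k k' e1 f1) k'' e3 f3 e3).trans ?_
    refine Eq.trans ?_
      (tensorMul_tmk _ _ _ _ k (mul_compat a' a'' b' b'' k' k'' e2 f2) e4 f4 e4).symm
    exact congrArg (tmk _ _) (Subtype.ext (Prod.ext (Λ.mul_assoc _ _ _ _ _ _ _) (Μ.mul_assoc _ _ _ _ _ _ _)))
  one_mul := by
    rintro ⟨⟨⟨a, b⟩, h⟩⟩ e
    have k : Λ.proj a = Μ.proj b := h
    refine (tensorMul_tmk (Λ.one (Λ.proj a).r) a (Μ.one (Λ.proj a).r) b _ h (Λ.s_one_eq _)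
      ((Μ.s_one_eq _).trans (by rw [k])) _).trans ?_
    refine congrArg _ (Subtype.ext (Prod.ext (Λ.one_mul _ _) ?_))
    exact (Μ.mul_congr _ (by rw [k]) rfl (Μ.s_one_eq _)).trans (Μ.one_mul b _)
  mul_one := by
    rintro ⟨⟨⟨a, b⟩, h⟩⟩ e
    have k : Λ.proj a = Μ.proj b := h
    refine (tensorMul_tmk a (Λ.one (Λ.proj a).s) b (Μ.one (Λ.proj a).s) h _ (Λ.r_one_eq _).symm
      (((Μ.r_one_eq _).trans (by rw [k])).symm) _).trans ?_
    refine congrArg _ (Subtype.ext (Prod.ext (Λ.mul_one _ _) ?_))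
    exact (Μ.mul_congr _ rfl (by rw [k]) (Μ.r_one_eq _).symm).trans (Μ.mul_one b _)
  inv_mul := by
    rintro ⟨⟨⟨a, b⟩, h⟩⟩ e
    have k : Λ.proj a = Μ.proj b := h
    refine (tensorMul_tmk (Λ.inv a) a (Μ.inv b) b _ h (Λ.s_inv_eq _) (Μ.s_inv_eq _) _).trans ?_
    refine congrArg _ (Subtype.ext (Prod.ext (Λ.inv_mul _ _) ?_))
    refine (Μ.inv_mul _ _).trans ?_
    rw [← k]; rfl
  mul_inv := by
    rintro ⟨⟨⟨a, b⟩, h⟩⟩ e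
    have k : Λ.proj a = Μ.proj b := h
    refine (tensorMul_tmk a (Λ.inv a) b (Μ.inv b) h _ (Λ.r_inv_eq _) (Μ.r_inv_eq _) _).trans ?_
    refine congrArg _ (Subtype.ext (Prod.ext (Λ.mul_inv _ _) ?_))
    refine (Μ.mul_inv _ _).trans ?_
    rw [← k]; rfl
  act_mul_act := by
    rintro z w ⟨⟨⟨a, b⟩, h⟩⟩ ⟨⟨⟨a', b'⟩, h'⟩⟩ e e2
    have k : Λ.proj a = Μ.proj b := h
    have k' : Λ.proj a' = Μ.proj b' := h'
    have e1 : (Λ.proj a).s = (Λ.proj a').r := e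
    have f1 : (Μ.proj b).s = (Μ.proj b').r := by rw [← k, ← k']; exact e1
    have g1 : (Λ.proj (Λ.act z a)).s = (Λ.proj (Λ.act w a')).r := by
      rw [Λ.proj_act, Λ.proj_act]; exact e1
    refine (tensorMul_tmk (Λ.act z a) (Λ.act w a') b b' ((Λ.proj_act _ _).trans k)
      ((Λ.proj_act _ _).trans k') g1 f1 e2).trans ?_
    refine Eq.trans ?_ (congrArg _ (tensorMul_tmk a a' b b' k k' e1 f1 e).symm)
    exact congrArg (tmk _ _) (Subtype.ext (Prod.ext (Λ.act_mul_act z w a a' e1 g1) rfl))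
  continuous_mul := by
    have hoq := (((isOpenQuotientMap_tmk Λ.toCircleBundle Μ.toCircleBundle).prodMap
      (isOpenQuotientMap_tmk Λ.toCircleBundle Μ.toCircleBundle)).restrictPreimage
        {q : TensorSpace Λ.toCircleBundle Μ.toCircleBundle ×
            TensorSpace Λ.toCircleBundle Μ.toCircleBundle |
          ((Λ.toCircleBundle.tensor Μ.toCircleBundle).proj q.1).s =
            ((Λ.toCircleBundle.tensor Μ.toCircleBundle).proj q.2).r})
    refine hoq.continuous_comp_iff.1 ?_
    let Y := (Prod.map (tmk Λ.toCircleBundle Μ.toCircleBundle)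
      (tmk Λ.toCircleBundle Μ.toCircleBundle)) ⁻¹'
        {q : TensorSpace Λ.toCircleBundle Μ.toCircleBundle ×
            TensorSpace Λ.toCircleBundle Μ.toCircleBundle |
          ((Λ.toCircleBundle.tensor Μ.toCircleBundle).proj q.1).s =
            ((Λ.toCircleBundle.tensor Μ.toCircleBundle).proj q.2).r}
    have e1 : ∀ q : Y, (Λ.proj q.1.1.1.1).s = (Λ.proj q.1.2.1.1).r := fun q => q.2
    have f1 : ∀ q : Y, (Μ.proj q.1.1.1.2).s = (Μ.proj q.1.2.1.2).r := fun q => by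
      rw [← q.1.1.2, ← q.1.2.2]; exact e1 q
    have hc : Continuous fun q : Y => tmk Λ.toCircleBundle Μ.toCircleBundle
        ⟨(Λ.mul q.1.1.1.1 q.1.2.1.1 (e1 q), Μ.mul q.1.1.1.2 q.1.2.1.2 (f1 q)),
          mul_compat _ _ _ _ q.1.1.2 q.1.2.2 _ _⟩ := by
      refine (isOpenQuotientMap_tmk Λ.toCircleBundle Μ.toCircleBundle).continuous.comp
        (Continuous.subtype_mk (Continuous.prodMk ?_ ?_) _)
      · exact Λ.continuous_mul.comp (f := fun q : Y =>
          (⟨(q.1.1.1.1, q.1.2.1.1), e1 q⟩ : {q : Λ.E × Λ.E // (Λ.proj q.1).s = (Λ.proj q.2).r}))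
          (by fun_prop)
      · exact Μ.continuous_mul.comp (f := fun q : Y =>
          (⟨(q.1.1.1.2, q.1.2.1.2), f1 q⟩ : {q : Μ.E × Μ.E // (Μ.proj q.1).s = (Μ.proj q.2).r}))
          (by fun_prop)
    refine hc.congr ?_
    intro q
    exact (tensorMul_tmk _ _ _ _ q.1.1.2 q.1.2.2 (e1 q) (f1 q) q.2).symm
  continuous_one := (isOpenQuotientMap_tmk Λ.toCircleBundle Μ.toCircleBundle).continuous.comp
    (Continuous.subtype_mk (Λ.continuous_one.prodMk Μ.continuous_one) _)
  continuous_inv := by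
    refine (isOpenQuotientMap_tmk Λ.toCircleBundle Μ.toCircleBundle).continuous_comp_iff.1 ?_
    refine (isOpenQuotientMap_tmk Λ.toCircleBundle Μ.toCircleBundle).continuous.comp
      (Continuous.subtype_mk (Continuous.prodMk ?_ ?_) _)
    · exact Λ.continuous_inv.comp (by fun_prop)
    · exact Μ.continuous_inv.comp (by fun_prop)

/-- Isomorphism of twists as an equivalence relation. -/
instance isoSetoid (σ : X → X) : Setoid (Twist σ) where
  r Λ Μ := Nonempty (Iso Λ Μ)
  iseqv :=
    { refl := fun Λ => ⟨isoOfHom (CircleBundle.Hom.id _) (fun _ _ _ _ => rfl)⟩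
      symm := by
        rintro Λ Μ ⟨f⟩
        refine ⟨isoOfHom f.toIso.inv ?_⟩
        intro a b h h'
        apply f.toEquiv.injective
        refine Eq.trans (f.right_inv _) ?_
        have h2 : (Μ.proj (f.toFun (f.invFun a))).s = (Μ.proj (f.toFun (f.invFun b))).r := by
          rw [f.right_inv, f.right_inv]; exact h
        refine Eq.trans ?_ (f.map_mul (f.invFun a) (f.invFun b) h' h2).symm
        exact Μ.mul_congr _ (f.right_inv _).symm (f.right_inv _).symm _
      trans := by
        rintro Λ Μ Ν ⟨f⟩ ⟨g⟩
        refine ⟨isoOfHom (g.toIso.hom.comp f.toIso.hom) ?_⟩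
        intro a b h h'
        have h2 : (Μ.proj (f.toFun a)).s = (Μ.proj (f.toFun b)).r := by
          rw [f.proj_map, f.proj_map]; exact h
        exact (congrArg g.toFun (f.map_mul a b h h2)).trans (g.map_mul _ _ h2 h') }

open CircleBundle

lemma baer_map {Λ Λ' Μ Μ' : Twist σ} (f : Iso Λ Λ') (g : Iso Μ Μ') :
    Nonempty (Iso (baer Λ Μ) (baer Λ' Μ')) := by
  refine ⟨isoOfHom (tensorMap f.toIso.hom g.toIso.hom) ?_⟩
  rintro ⟨⟨⟨a, b⟩, h⟩⟩ ⟨⟨⟨a', b'⟩, h'⟩⟩ e e'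
  have k : Λ.proj a = Μ.proj b := h
  have k' : Λ.proj a' = Μ.proj b' := h'
  have e1 : (Λ.proj a).s = (Λ.proj a').r := e
  have f1 : (Μ.proj b).s = (Μ.proj b').r := by rw [← k, ← k']; exact e1
  have e2 : (Λ'.proj (f.toFun a)).s = (Λ'.proj (f.toFun a')).r := by
    rw [f.proj_map, f.proj_map]; exact e1
  have f2 : (Μ'.proj (g.toFun b)).s = (Μ'.proj (g.toFun b')).r := by
    rw [g.proj_map, g.proj_map]; exact f1
  refine (congrArg (tensorMap f.toIso.hom g.toIso.hom).toFun
    (tensorMul_tmk a a' b b' k k' e1 f1 e)).trans ?_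
  refine Eq.trans ?_ (tensorMul_tmk (f.toFun a) (f.toFun a') (g.toFun b) (g.toFun b')
    ((f.proj_map a).trans (k.trans (g.proj_map b).symm))
    ((f.proj_map a').trans (k'.trans (g.proj_map b').symm)) e2 f2 e').symm
  exact congrArg (tmk _ _) (Subtype.ext (Prod.ext (f.map_mul _ _ e1 e2) (g.map_mul _ _ f1 f2)))

lemma conj_map {Λ Λ' : Twist σ} (f : Iso Λ Λ') : Nonempty (Iso (conj Λ) (conj Λ')) :=
  ⟨isoOfHom (conjMap f.toIso.hom) f.map_mul⟩

lemma baer_comm (Λ Μ : Twist σ) : Nonempty (Iso (baer Λ Μ) (baer Μ Λ)) := by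
  refine ⟨isoOfHom (tensorComm _ _) ?_⟩
  rintro ⟨⟨⟨a, b⟩, h⟩⟩ ⟨⟨⟨a', b'⟩, h'⟩⟩ e e'
  have k : Λ.proj a = Μ.proj b := h
  have k' : Λ.proj a' = Μ.proj b' := h'
  have e1 : (Λ.proj a).s = (Λ.proj a').r := e
  have f1 : (Μ.proj b).s = (Μ.proj b').r := by rw [← k, ← k']; exact e1
  refine (congrArg (tensorComm Λ.toCircleBundle Μ.toCircleBundle).toFun
    (tensorMul_tmk a a' b b' k k' e1 f1 e)).trans ?_
  exact (tensorMul_tmk b b' a a' k.symm k'.symm f1 e1 e').symm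

lemma baer_assoc (Λ Μ Ν : Twist σ) :
    Nonempty (Iso (baer (baer Λ Μ) Ν) (baer Λ (baer Μ Ν))) := by
  refine ⟨isoOfHom (tensorAssoc _ _ _) ?_⟩
  rintro ⟨⟨⟨⟨⟨⟨a, b⟩, h⟩⟩, c⟩, i⟩⟩ ⟨⟨⟨⟨⟨⟨a', b'⟩, h'⟩⟩, c'⟩, i'⟩⟩ e e'
  have k : Λ.proj a = Μ.proj b := h
  have k' : Λ.proj a' = Μ.proj b' := h'
  have l : Μ.proj b = Ν.proj c := k.symm.trans i
  have l' : Μ.proj b' = Ν.proj c' := k'.symm.trans i'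
  have e1 : (Λ.proj a).s = (Λ.proj a').r := e
  have f1 : (Μ.proj b).s = (Μ.proj b').r := by rw [← k, ← k']; exact e1
  have g1 : (Ν.proj c).s = (Ν.proj c').r := by rw [← l, ← l']; exact f1
  let T := tensorAssoc Λ.toCircleBundle Μ.toCircleBundle Ν.toCircleBundle
  have A := tensorAssoc_apply a b c k l
  have A' := tensorAssoc_apply a' b' c' k' l'
  have C : ∀ p p' q q' : (baer Λ (baer Μ Ν)).E, p = p' → q = q' →
      ∀ u v, (baer Λ (baer Μ Ν)).mul p q u = (baer Λ (baer Μ Ν)).mul p' q' v := by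
    rintro p _ q _ rfl rfl u v; rfl
  have M1 := tensorMul_tmk (Λ := baer Λ Μ) (Μ := Ν)
    (tmk Λ.toCircleBundle Μ.toCircleBundle ⟨(a, b), k⟩)
    (tmk Λ.toCircleBundle Μ.toCircleBundle ⟨(a', b'), k'⟩) c c' i i' e g1 e
  have M2 := tensorMul_tmk a a' b b' k k' e1 f1 e
  have i3 : Λ.proj (Λ.mul a a' e1) = Ν.proj (Ν.mul c c' g1) :=
    (mul_compat a a' b b' k k' e1 f1).trans (mul_compat b b' c c' l l' f1 g1)
  have M3 : tmk (baer Λ Μ).toCircleBundle Ν.toCircleBundle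
      ⟨((baer Λ Μ).mul (tmk Λ.toCircleBundle Μ.toCircleBundle ⟨(a, b), k⟩)
        (tmk Λ.toCircleBundle Μ.toCircleBundle ⟨(a', b'), k'⟩) e, Ν.mul c c' g1),
        mul_compat _ _ _ _ i i' e g1⟩ = tmk (baer Λ Μ).toCircleBundle Ν.toCircleBundle
      ⟨(tmk Λ.toCircleBundle Μ.toCircleBundle ⟨(Λ.mul a a' e1, Μ.mul b b' f1),
        mul_compat a a' b b' k k' e1 f1⟩, Ν.mul c c' g1), i3⟩ :=
    congrArg (tmk _ _) (Subtype.ext (Prod.ext M2 rfl))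
  refine (congrArg T.toFun (M1.trans M3)).trans ?_
  refine (tensorAssoc_apply (Λ.mul a a' e1) (Μ.mul b b' f1) (Ν.mul c c' g1)
    (mul_compat a a' b b' k k' e1 f1) (mul_compat b b' c c' l l' f1 g1)).trans ?_
  refine Eq.trans ?_ (C _ _ _ _ A A' e' e1).symm
  have N1 := tensorMul_tmk (Λ := Λ) (Μ := baer Μ Ν) a a'
    (tmk Μ.toCircleBundle Ν.toCircleBundle ⟨(b, c), l⟩)
    (tmk Μ.toCircleBundle Ν.toCircleBundle ⟨(b', c'), l'⟩) k k' e1 f1 e1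
  refine Eq.trans ?_ N1.symm
  have N2 := tensorMul_tmk b b' c c' l l' f1 g1 f1
  exact congrArg (tmk _ _) (Subtype.ext (Prod.ext rfl N2.symm))

lemma trivial_baer (hσ : IsLocalHomeomorph σ) (Λ : Twist σ) :
    Nonempty (Iso (baer (trivial hσ) Λ) Λ) := by
  refine ⟨isoOfHom (trivialTensor _) ?_⟩
  rintro ⟨⟨⟨a, b⟩, h⟩⟩ ⟨⟨⟨a', b'⟩, h'⟩⟩ e e'
  have k : a.1 = Λ.proj b := h
  have k' : a'.1 = Λ.proj b' := h'
  have e1 : a.1.s = a'.1.r := e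
  have f1 : (Λ.proj b).s = (Λ.proj b').r := by rw [← k, ← k']; exact e1
  refine (congrArg (trivialTensor Λ.toCircleBundle).toFun
    (tensorMul_tmk (Λ := trivial hσ) a a' b b' k k' e1 f1 e)).trans ?_
  exact (Λ.act_mul_act a.2 a'.2 b b' f1 e').symm

lemma conj_baer (hσ : IsLocalHomeomorph σ) (Λ : Twist σ) :
    Nonempty (Iso (baer (conj Λ) Λ) (trivial hσ)) := by
  refine ⟨isoOfHom (Μ := trivial hσ) (conjTensor _) ?_⟩
  rintro ⟨⟨⟨a, b⟩, h⟩⟩ ⟨⟨⟨a', b'⟩, h'⟩⟩ e e'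
  have k : Λ.proj a = Λ.proj b := h
  have k' : Λ.proj a' = Λ.proj b' := h'
  have e1 : (Λ.proj a).s = (Λ.proj a').r := e
  have f1 : (Λ.proj b).s = (Λ.proj b').r := by rw [← k, ← k']; exact e1
  refine (congrArg (conjTensor Λ.toCircleBundle).toFun
    (tensorMul_tmk (Λ := conj Λ) a a' b b' k k' e1 f1 e)).trans ?_
  refine Prod.ext (Λ.proj_mul a a' e1) ?_
  change Λ.ratio (Λ.mul a a' e1) (Λ.mul b b' f1)
    (mul_compat (Λ := Λ) (Μ := Λ) a a' b b' k k' e1 f1) = Λ.ratio a b k * Λ.ratio a' b' k'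
  obtain ⟨z, rfl⟩ := Λ.exists_smul k
  obtain ⟨w, rfl⟩ := Λ.exists_smul k'
  rw [ratio_eq k rfl, ratio_eq k' rfl]
  exact ratio_eq _ (Λ.act_mul_act z w a a' e1 f1)

end Twist

/-- The twist group `Tw(Γ(X, σ))`: isomorphism classes of twists over `Γ(X, σ)`. -/
def Tw (σ : X → X) (_hσ : IsLocalHomeomorph σ) : Type (u + 1) := Quotient (Twist.isoSetoid σ)

/-- The isomorphism class of a twist. -/
def Twist.cls (hσ : IsLocalHomeomorph σ) (Λ : Twist σ) : Tw σ hσ := Quotient.mk _ Λ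

/-- The group structure on isomorphism classes of twists: the product is the Baer sum, the inverse
is the conjugate twist. -/
instance (hσ : IsLocalHomeomorph σ) : CommGroup (Tw σ hσ) where
  mul := Quotient.map₂ Twist.baer (fun _ _ ⟨f⟩ _ _ ⟨g⟩ => Twist.baer_map f g)
  one := (Twist.trivial hσ).cls hσ
  inv := Quotient.map Twist.conj (fun _ _ ⟨f⟩ => Twist.conj_map f)
  mul_assoc := by
    rintro ⟨P⟩ ⟨Q⟩ ⟨R⟩
    exact Quotient.sound (Twist.baer_assoc P Q R)
  one_mul := by
    rintro ⟨P⟩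
    exact Quotient.sound (Twist.trivial_baer hσ P)
  mul_one := by
    rintro ⟨P⟩
    exact Quotient.sound (Setoid.trans (Twist.baer_comm P (Twist.trivial hσ))
      (Twist.trivial_baer hσ P))
  inv_mul_cancel := by
    rintro ⟨P⟩
    exact Quotient.sound (Twist.conj_baer hσ P)
  mul_comm := by
    rintro ⟨P⟩ ⟨Q⟩
    exact Quotient.sound (Twist.baer_comm P Q)

/-- The circle bundle `j^*(Λ)` over `X`, for `j(x) = (x, 1, σ x)`. -/
def Twist.pullbackJ (hσ : IsLocalHomeomorph σ) (Λ : Twist σ) : CircleBundle X :=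
  Λ.toCircleBundle.pullback (Gpd.j σ) (Gpd.continuous_j hσ)

/-! ## The twist of a circle bundle -/

namespace CircleBundle

/-- Tuples `(z, γ, u₁, …, u_k, v₁, …, v_l)` where `γ = (x, k - l, y)` lies in `X_{k,l}`, `z` is in
the circle, `u_i` lies over `σ^{i-1}(x)` and `v_i` lies over `σ^{i-1}(y)`. Such a tuple represents
the point `z (u₁, …, u_k, v̄_l, …, v̄₁)` over `γ` of the pullback `T_{k,l}` of `T^k ⋆ T̄^l` along
`(x, k - l, y) ↦ (x, σ x, …, σ^{k-1} x, σ^{l-1} y, …, σ y, y)`. (The factor `z` makes this correct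
for `k = l = 0`, when `T_{0,0}` is the trivial bundle.) -/
@[ext]
structure Tuple (T : CircleBundle X) (σ : X → X) (k l : ℕ) : Type u where
  base : Gpd σ
  z : Circle
  u : Fin k → T.E
  v : Fin l → T.E
  base_mem : base ∈ Gpd.layer σ k l
  proj_u : ∀ i : Fin k, T.proj (u i) = σ^[i] base.r
  proj_v : ∀ i : Fin l, T.proj (v i) = σ^[i] base.s

/-- The topology of a subspace of the product `Γ × Circle × T^k × T^l`. -/
instance (T : CircleBundle X) (σ : X → X) (k l : ℕ) : TopologicalSpace (Tuple T σ k l) :=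
  TopologicalSpace.induced (fun p => (p.base, p.z, p.u, p.v)) inferInstance

/-- The generating identifications of the bundle `Λ_T`. -/
inductive GlueRel (T : CircleBundle X) (σ : X → X) :
    (Σ n : ℕ × ℕ, Tuple T σ n.1 n.2) → (Σ n : ℕ × ℕ, Tuple T σ n.1 n.2) → Prop
  /-- The identifications in `T_{k,l}`: scalars move between the factors, and `w v` has conjugate
  `w⁻¹ v̄`. -/
  | star {k l : ℕ} (p q : Tuple T σ k l) (a : Fin k → Circle) (b : Fin l → Circle)
      (hbase : p.base = q.base) (hu : ∀ i, p.u i = a i • q.u i) (hv : ∀ i, p.v i = b i • q.v i)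
      (hz : q.z = p.z * (∏ i, a i) * (∏ i, b i)⁻¹) : GlueRel T σ ⟨(k, l), p⟩ ⟨(k, l), q⟩
  /-- The identification of the restriction of `T_{k+1,l+1}` to `X_{k,l}` with `T_{k,l}`:
  `(u₁, …, u_{k+1}, v̄_{l+1}, …, v̄₁) ↦ w (u₁, …, u_k, v̄_l, …, v̄₁)` with `u_{k+1} = w v_{l+1}`. -/
  | glue {k l : ℕ} (p : Tuple T σ (k + 1) (l + 1)) (q : Tuple T σ k l) (w : Circle)
      (hbase : p.base = q.base) (hu : ∀ i : Fin k, p.u i.castSucc = q.u i)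
      (hv : ∀ i : Fin l, p.v i.castSucc = q.v i) (hw : p.u (Fin.last k) = w • p.v (Fin.last l))
      (hz : q.z = p.z * w) : GlueRel T σ ⟨(k + 1, l + 1), p⟩ ⟨(k, l), q⟩

/-- The total space of `Λ_T`: the spaces `T_{k,l}` glued together. -/
def GlueSpace (T : CircleBundle X) (σ : X → X) : Type u := Quot (GlueRel T σ)

instance (T : CircleBundle X) (σ : X → X) : TopologicalSpace (GlueSpace T σ) :=
  inferInstanceAs (TopologicalSpace (Quot (GlueRel T σ)))

/-- The point of `Λ_T` represented by a tuple. -/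
def Tuple.pt {T : CircleBundle X} {σ : X → X} {k l : ℕ} (p : Tuple T σ k l) : GlueSpace T σ :=
  Quot.mk _ ⟨(k, l), p⟩

/-- The twist `Λ` is (up to a homeomorphism `h` of the total spaces) the twist `Λ_T`: the glued
space, with the evident projection and circle action, with the product
`(t₁, …, t_i, ū_k, …, ū₁) (v₁, …, v_k, w̄_l, …, w̄₁) = (∏ v_n ū_n) (t₁, …, t_i, w̄_l, …, w̄₁)`,
where `v ū` is the scalar `a` with `v = a u`, and with the inverse
`(u₁, …, u_k, v̄_l, …, v̄₁)⁻¹ = (v₁, …, v_l, ū_k, …, ū₁)`. -/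
def IsTwistOf (T : CircleBundle X) (Λ : Twist σ) : Prop :=
  ∃ h : GlueSpace T σ ≃ₜ Λ.E,
    (∀ (k l : ℕ) (p : Tuple T σ k l), Λ.proj (h p.pt) = p.base) ∧
    (∀ (k l : ℕ) (p : Tuple T σ k l) (w : Circle),
      h (Tuple.pt { p with z := w * p.z }) = w • h p.pt) ∧
    (∀ (i k l : ℕ) (p : Tuple T σ i k) (q : Tuple T σ k l) (pq : Tuple T σ i l)
      (a : Fin k → Circle) (hc : p.base.s = q.base.r)
      (hc' : (Λ.proj (h p.pt)).s = (Λ.proj (h q.pt)).r),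
      (∀ n, q.u n = a n • p.v n) → pq.base = p.base.mul q.base hc → pq.u = p.u → pq.v = q.v →
      pq.z = p.z * q.z * ∏ n, a n → Λ.mul (h p.pt) (h q.pt) hc' = h pq.pt) ∧
    (∀ (k l : ℕ) (p : Tuple T σ k l) (q : Tuple T σ l k),
      q.base = p.base.inv → q.u = p.v → q.v = p.u → q.z = p.z⁻¹ → Λ.inv (h p.pt) = h q.pt)

end CircleBundle

end CircleTwist

end

open CircleTwist

/-! The pullback along `j` respects products of circle bundles, so it is a homomorphism on classes
(`pullbackJHom`). It remains to see that it is injective and that `Λ_T` is a twist that restricts to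
`T`.

Injectivity. The elements `j(x)` generate `Γ`: if `σ^k x = σ^l y`, then `(x, k - l, y)` is `j(x) ⋯
j(σ^{k-1} x)` times the inverse of `j(y) ⋯ j(σ^{l-1} y)`. If `Λ` has a continuous section `f` over
`j`, a multiplicative section extending `f` must send this element to `F_k(x) F_l(y)⁻¹` with `F_k(x)
= f(x) ⋯ f(σ^{k-1} x)`. Two levels `(k, l)` of one element differ by some `(n, n)`, and raising both
by one inserts `f(σ^k x) f(σ^l y)⁻¹`, which is a unit. So the value is independent of the level
(`Twist.IsLift.of_layer`). It is multiplicative, and it is continuous on each open set `X_{k,l}`;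
this trivializes `Λ` (`Twist.nonempty_iso_trivial`).

Surjectivity. Choose a section `basePt` of `T`, with no continuity at all. The coordinates of the
entries of a tuple combine to one scalar that respects the identifications, and the glued space
becomes the set `Γ × Circle` (`glueEquiv`). The operations become those of the trivial twist, so the
algebraic axioms come for free. Only the topology is twisted: near `γ₀` the continuous coordinate is
the scalar divided by `gpdCoord k l γ₀`, the scalar of a tuple of continuous local sections of `T`.
This function does not depend on the level (`gpdCoord_level`), and it respects products and inverses
(`gpdCoord_mul`, `gpdCoord_inv`); hence there are charts and the operations are continuous. Finally
`T` is `T_{1,0}`, which lies over the image of `j`, so that `j^*(Λ_T)` is `T`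
(`nonempty_iso_of_isTwistOf`). -/

namespace CircleTwist

/-! ### Pullbacks of circle bundles and their products. -/

namespace CircleBundle

variable {A B : Type u} [TopologicalSpace A] [TopologicalSpace B]

/-- Functoriality of the pullback. -/
def pullbackMap (f : A → B) (hf : Continuous f) {P Q : CircleBundle B} (g : Hom P Q) :
    Hom (P.pullback f hf) (Q.pullback f hf) where
  toFun q := ⟨(q.1.1, g.toFun q.1.2), q.2.trans (g.proj_map _).symm⟩
  cont := Continuous.subtype_mk ((continuous_fst.comp continuous_subtype_val).prodMk
    (g.cont.comp (continuous_snd.comp continuous_subtype_val))) _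
  proj_map _ := rfl
  map_smul z q := Subtype.ext (Prod.ext rfl (g.map_smul z q.1.2))

lemma continuous_pullback_val (f : A → B) (hf : Continuous f) (P : CircleBundle B) :
    Continuous fun q : (P.pullback f hf).E => (q.1 : A × P.E) := continuous_subtype_val

lemma continuous_fibreProd_fst (P Q : CircleBundle B) :
    Continuous fun q : FibreProd P Q => q.1.1 := continuous_fst.comp continuous_subtype_val

lemma continuous_fibreProd_snd (P Q : CircleBundle B) :
    Continuous fun q : FibreProd P Q => q.1.2 := continuous_snd.comp continuous_subtype_val

/-- The pullback is compatible with products. -/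
def pullbackTensor (f : A → B) (hf : Continuous f) (P Q : CircleBundle B) :
    Hom (tensor (P.pullback f hf) (Q.pullback f hf)) ((tensor P Q).pullback f hf) :=
  tensorHom (P := P.pullback f hf) (Q := Q.pullback f hf) (R := (tensor P Q).pullback f hf)
    (fun q => ⟨(q.1.1.1.1, tmk P Q ⟨(q.1.1.1.2, q.1.2.1.2),
      q.1.1.2.symm.trans ((congrArg f q.2).trans q.1.2.2)⟩), q.1.1.2⟩)
    (by
      have h1 := (continuous_pullback_val f hf P).comp
        (continuous_fibreProd_fst (P.pullback f hf) (Q.pullback f hf))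
      have h2 := (continuous_pullback_val f hf Q).comp
        (continuous_fibreProd_snd (P.pullback f hf) (Q.pullback f hf))
      exact Continuous.subtype_mk ((continuous_fst.comp h1).prodMk
        ((isOpenQuotientMap_tmk P Q).continuous.comp (Continuous.subtype_mk
          ((continuous_snd.comp h1).prodMk (continuous_snd.comp h2)) _))) _)
    (fun _ => rfl)
    (fun _ _ _ _ _ => rfl)
    (fun z x y h _ => Subtype.ext (Prod.ext rfl
      (tmk_smul_right z x.1.2 y.1.2 (x.2.symm.trans ((congrArg f h).trans y.2)))))

end CircleBundle

/-! ### Levels of the elements of `Γ`. -/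

variable {X : Type u} {σ : X → X}

lemma Gpd.layer_add {γ : Gpd σ} {k l : ℕ} (h : γ ∈ Gpd.layer σ k l) (n : ℕ) :
    γ ∈ Gpd.layer σ (k + n) (l + n) :=
  ⟨by rw [add_comm, Function.iterate_add_apply, h.1, ← Function.iterate_add_apply, add_comm],
    by rw [← h.2]; push_cast; ring⟩

/-- Two levels of the same element of `Γ` are comparable. -/
lemma Gpd.layer_cases {γ : Gpd σ} {k l k' l' : ℕ} (h : γ ∈ Gpd.layer σ k l)
    (h' : γ ∈ Gpd.layer σ k' l') :
    (∃ n, k' = k + n ∧ l' = l + n) ∨ ∃ n, k = k' + n ∧ l = l' + n := by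
  -- Both levels have the same difference, so whatever is added to `k` is also added to `l`.
  have e := h.2.trans h'.2.symm
  rcases le_total k k' with hk | hk
  · exact Or.inl ⟨k' - k, by omega, by omega⟩
  · exact Or.inr ⟨k - k', by omega, by omega⟩

/-- The element `(x, k, σ^k x)`. -/
def Gpd.path (σ : X → X) (k : ℕ) (x : X) : Gpd σ := ⟨x, k, σ^[k] x, k, 0, rfl, by simp⟩

variable [TopologicalSpace X]

/-! ### Triviality of a twist that has a continuous section over `j`. -/

namespace Twist

lemma mul_right_cancel (Λ : Twist σ) {a b c : Λ.E} (h : (Λ.proj a).s = (Λ.proj c).r)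
    (h' : (Λ.proj b).s = (Λ.proj c).r) (e : Λ.mul a c h = Λ.mul b c h') : a = b := by
  have key : ∀ (d : Λ.E) (hd : (Λ.proj d).s = (Λ.proj c).r) (hd'),
      Λ.mul (Λ.mul d c hd) (Λ.inv c) hd' = d := by
    intro d hd hd'
    have h4 : (Λ.proj d).s = (Λ.proj (Λ.mul c (Λ.inv c) (Λ.r_inv_eq c))).r := by
      rw [Λ.proj_mul]; exact hd
    rw [Λ.mul_assoc d c (Λ.inv c) hd hd' (Λ.r_inv_eq c) h4,
      Λ.mul_congr h4 rfl ((Λ.mul_inv c _).trans (by rw [hd])) (Λ.r_one_eq _).symm]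
    exact Λ.mul_one _ _
  have h1 : ∀ (d : Λ.E) (hd : (Λ.proj d).s = (Λ.proj c).r),
      (Λ.proj (Λ.mul d c hd)).s = (Λ.proj (Λ.inv c)).r := by
    intro d hd
    rw [Λ.proj_mul]
    exact Λ.r_inv_eq c
  rw [← key a h (h1 a h), ← key b h' (h1 b h')]
  exact Λ.mul_congr _ e rfl _

/-- The products `f(x) f(σ x) ⋯ f(σ^{k-1} x)` for a section `f` of `Λ` over `j`. -/
def pathLift (Λ : Twist σ) (f : X → Λ.E) (hf : ∀ x, Λ.proj (f x) = Gpd.j σ x) :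
    ∀ k : ℕ, {F : X → Λ.E // ∀ x, Λ.proj (F x) = Gpd.path σ k x}
  | 0 => ⟨Λ.one, fun x => (Λ.proj_one x).trans (Gpd.ext rfl rfl rfl)⟩
  | k + 1 => ⟨fun x => Λ.mul ((pathLift Λ f hf k).1 x) (f (σ^[k] x))
      (by rw [(pathLift Λ f hf k).2, hf]; rfl), fun x => by
        rw [Λ.proj_mul]
        simp only [(pathLift Λ f hf k).2, hf]
        exact Gpd.ext rfl (by simp [Gpd.mul, Gpd.path, Gpd.j])
          (Function.iterate_succ_apply' σ k x).symm⟩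

lemma continuous_pathLift (hσ : IsLocalHomeomorph σ) (Λ : Twist σ) (f : X → Λ.E)
    (hf : ∀ x, Λ.proj (f x) = Gpd.j σ x) (hc : Continuous f) (k : ℕ) :
    Continuous (pathLift Λ f hf k).1 := by
  induction k with
  | zero => exact Λ.continuous_one
  | succ k ih =>
    exact Λ.continuous_mul.comp (f := fun x =>
      (⟨((pathLift Λ f hf k).1 x, f (σ^[k] x)), by rw [(pathLift Λ f hf k).2, hf]; rfl⟩ :
        {q : Λ.E × Λ.E // (Λ.proj q.1).s = (Λ.proj q.2).r}))
      (Continuous.subtype_mk (ih.prodMk (hc.comp (hσ.continuous.iterate k)))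
        (fun x => by rw [(pathLift Λ f hf k).2, Function.comp_apply, hf]; rfl))

/-- The point `e` over `γ = (x, k - l, y)` satisfies
`e f(y) ⋯ f(σ^{l-1} y) = f(x) ⋯ f(σ^{k-1} x)`. -/
def IsLift (Λ : Twist σ) (f : X → Λ.E) (hf : ∀ x, Λ.proj (f x) = Gpd.j σ x) (k l : ℕ)
    (γ : Gpd σ) (e : Λ.E) : Prop :=
  Λ.proj e = γ ∧ ∃ h, Λ.mul e ((pathLift Λ f hf l).1 γ.s) h = (pathLift Λ f hf k).1 γ.r

variable {Λ : Twist σ} {f : X → Λ.E} {hf : ∀ x, Λ.proj (f x) = Gpd.j σ x} {k l : ℕ} {γ : Gpd σ}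

/-- Right cancellation. Because the equation has only one solution, change of level, products and
continuity can all be checked on the equation instead of on a formula with inverses. -/
lemma IsLift.unique {a b : Λ.E} (ha : IsLift Λ f hf k l γ a) (hb : IsLift Λ f hf k l γ b) :
    a = b := by
  obtain ⟨-, h, e⟩ := ha
  obtain ⟨-, h', e'⟩ := hb
  exact Λ.mul_right_cancel h h' (e.trans e'.symm)

lemma pathLift_s_eq (hγ : γ ∈ Gpd.layer σ k l) :
    (Λ.proj ((pathLift Λ f hf k).1 γ.r)).s =
      (Λ.proj (Λ.inv ((pathLift Λ f hf l).1 γ.s))).r := by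
  rw [← Λ.r_inv_eq, (pathLift Λ f hf k).2, (pathLift Λ f hf l).2]
  exact hγ.1

/-- The explicit solution `F_k(x) F_l(y)⁻¹`. For continuous `f` it varies continuously with `γ` on a
fixed `X_{k,l}`. -/
lemma isLift_mul_inv (hγ : γ ∈ Gpd.layer σ k l) :
    IsLift Λ f hf k l γ (Λ.mul ((pathLift Λ f hf k).1 γ.r) (Λ.inv ((pathLift Λ f hf l).1 γ.s))
      (pathLift_s_eq hγ)) := by
  have hp : Λ.proj (Λ.mul ((pathLift Λ f hf k).1 γ.r) (Λ.inv ((pathLift Λ f hf l).1 γ.s))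
      (pathLift_s_eq hγ)) = γ := by
    rw [Λ.proj_mul]
    simp only [Λ.proj_inv, (pathLift Λ f hf k).2, (pathLift Λ f hf l).2]
    exact Gpd.ext rfl hγ.2 rfl
  have h1 : (Λ.proj (Λ.mul ((pathLift Λ f hf k).1 γ.r) (Λ.inv ((pathLift Λ f hf l).1 γ.s))
      (pathLift_s_eq hγ))).s = (Λ.proj ((pathLift Λ f hf l).1 γ.s)).r := by
    rw [hp, (pathLift Λ f hf l).2]; rfl
  have h2 := Λ.s_inv_eq ((pathLift Λ f hf l).1 γ.s)
  have h3 : (Λ.proj ((pathLift Λ f hf k).1 γ.r)).s = (Λ.proj (Λ.mul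
      (Λ.inv ((pathLift Λ f hf l).1 γ.s)) ((pathLift Λ f hf l).1 γ.s) h2)).r := by
    rw [Λ.proj_mul]; exact pathLift_s_eq hγ
  have h4 : (Λ.proj ((pathLift Λ f hf k).1 γ.r)).s = (Λ.proj ((pathLift Λ f hf l).1 γ.s)).s := by
    rw [(pathLift Λ f hf k).2, (pathLift Λ f hf l).2]; exact hγ.1
  refine ⟨hp, h1, ?_⟩
  rw [Λ.mul_assoc _ _ _ _ h1 h2 h3,
    Λ.mul_congr h3 rfl ((Λ.inv_mul _ _).trans (by rw [h4])) (Λ.r_one_eq _).symm]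
  exact Λ.mul_one _ _

/-- Both sides of the equation are multiplied on the right by the same element of `Λ`, because `σ^k
x = σ^l y`. -/
lemma IsLift.succ (hγ : γ ∈ Gpd.layer σ k l) {e : Λ.E} (he : IsLift Λ f hf k l γ e) :
    IsLift Λ f hf (k + 1) (l + 1) γ e := by
  obtain ⟨hp, h, e1⟩ := he
  have h1 : (Λ.proj e).s = (Λ.proj ((pathLift Λ f hf (l + 1)).1 γ.s)).r := by
    rw [hp, (pathLift Λ f hf (l + 1)).2]; rfl
  have h2 : (Λ.proj (Λ.mul e ((pathLift Λ f hf l).1 γ.s) h)).s = (Λ.proj (f (σ^[l] γ.s))).r := by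
    rw [Λ.proj_mul, hf]
    simp only [(pathLift Λ f hf l).2]
    rfl
  refine ⟨hp, h1, ?_⟩
  refine (Λ.mul_assoc e ((pathLift Λ f hf l).1 γ.s) (f (σ^[l] γ.s)) h h2 _ h1).symm.trans ?_
  exact Λ.mul_congr _ e1 (by rw [hγ.1]) _

lemma IsLift.add (hγ : γ ∈ Gpd.layer σ k l) {e : Λ.E} (he : IsLift Λ f hf k l γ e) (n : ℕ) :
    IsLift Λ f hf (k + n) (l + n) γ e := by
  induction n with
  | zero => exact he
  | succ n ih => exact ih.succ (Gpd.layer_add hγ n)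

/-- Upwards this is `IsLift.add`. Downwards, the solution at the lower level is raised to the higher
one, where uniqueness identifies it with `e`. -/
lemma IsLift.of_layer {k' l' : ℕ} (hγ : γ ∈ Gpd.layer σ k l) (hγ' : γ ∈ Gpd.layer σ k' l')
    {e : Λ.E} (he : IsLift Λ f hf k l γ e) : IsLift Λ f hf k' l' γ e := by
  have h' := isLift_mul_inv (Λ := Λ) (f := f) (hf := hf) hγ'
  rcases Gpd.layer_cases hγ hγ' with ⟨n, rfl, rfl⟩ | ⟨n, rfl, rfl⟩
  · exact he.add hγ n
  · rwa [he.unique (h'.add hγ' n)]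

/-- Telescoping, with `F` for `pathLift`: `a b F_l = a F_k = F_m`. The second level of `a` has to be
the first level of `b`. -/
lemma IsLift.mul {m : ℕ} {γ' : Gpd σ} {a b : Λ.E} (ha : IsLift Λ f hf m k γ a)
    (hb : IsLift Λ f hf k l γ' b) (h : (Λ.proj a).s = (Λ.proj b).r) (hγs : γ.s = γ'.r) :
    IsLift Λ f hf m l (γ.mul γ' hγs) (Λ.mul a b h) := by
  obtain ⟨hp, h1, e⟩ := ha
  obtain ⟨hp', h1', e'⟩ := hb
  have h2 : (Λ.proj (Λ.mul a b h)).s = (Λ.proj ((pathLift Λ f hf l).1 γ'.s)).r := by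
    rw [Λ.proj_mul]; exact h1'
  have h3 : (Λ.proj a).s = (Λ.proj (Λ.mul b ((pathLift Λ f hf l).1 γ'.s) h1')).r := by
    rw [Λ.proj_mul]; exact h
  refine ⟨by rw [Λ.proj_mul]; simp only [hp, hp'], h2, ?_⟩
  refine (Λ.mul_assoc a b _ h h2 h1' h3).trans (Eq.trans ?_ e)
  exact Λ.mul_congr _ rfl (e'.trans (by rw [hγs])) _

/-- A twist whose restriction along `j` has a continuous section is trivial. -/
lemma nonempty_iso_trivial (hσ : IsLocalHomeomorph σ) (Λ : Twist σ) (f : X → Λ.E)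
    (hf : ∀ x, Λ.proj (f x) = Gpd.j σ x) (hc : Continuous f) :
    Nonempty (Iso (trivial hσ) Λ) := by
  have key : ∀ γ : Gpd σ, ∃ e : Λ.E, ∀ k l, γ ∈ Gpd.layer σ k l → IsLift Λ f hf k l γ e := by
    intro γ
    obtain ⟨k, l, hγ⟩ := γ.mem
    exact ⟨_, fun k' l' hγ' => (isLift_mul_inv (k := k) (l := l) hγ).of_layer hγ hγ'⟩
  choose S hS using key
  have hproj : ∀ γ, Λ.proj (S γ) = γ := fun γ => by
    obtain ⟨k, l, hγ⟩ := γ.mem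
    exact (hS γ k l hγ).1
  have hcont : Continuous S := by
    rw [continuous_iff_continuousAt]
    intro γ
    obtain ⟨k, l, hγ⟩ := γ.mem
    have hγ : γ ∈ Gpd.layer σ k l := hγ
    -- The set `X_{k,l}` is open, and on it uniqueness identifies `S` with the explicit solution at
    -- the fixed level `(k, l)`.
    refine ContinuousOn.continuousAt ?_ ((Gpd.isOpen_layer k l).mem_nhds hγ)
    rw [continuousOn_iff_continuous_domRestrict]
    have h1 : Continuous fun γ : Gpd.layer σ k l => Λ.mul ((pathLift Λ f hf k).1 γ.1.r)
        (Λ.inv ((pathLift Λ f hf l).1 γ.1.s)) (pathLift_s_eq γ.2) :=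
      Λ.continuous_mul.comp (f := fun γ : Gpd.layer σ k l =>
        (⟨((pathLift Λ f hf k).1 γ.1.r, Λ.inv ((pathLift Λ f hf l).1 γ.1.s)),
          pathLift_s_eq γ.2⟩ : {q : Λ.E × Λ.E // (Λ.proj q.1).s = (Λ.proj q.2).r}))
        (Continuous.subtype_mk (((continuous_pathLift hσ Λ f hf hc k).comp
          (Gpd.continuous_r.comp continuous_subtype_val)).prodMk
          (Λ.continuous_inv.comp ((continuous_pathLift hσ Λ f hf hc l).comp
          (Gpd.continuous_s.comp continuous_subtype_val)))) _)
    exact h1.congr fun γ => (isLift_mul_inv γ.2).unique (hS γ.1 k l γ.2)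
  have hmul : ∀ (γ γ' : Gpd σ) (h : γ.s = γ'.r) h',
      S (γ.mul γ' h) = Λ.mul (S γ) (S γ') h' := by
    intro γ γ' h h'
    obtain ⟨i, k, hγ⟩ := γ.mem
    obtain ⟨k', l, hγ'⟩ := γ'.mem
    -- The levels `(i, k)` and `(k', l)` are raised by `k'` and by `k`, which gives them the common
    -- middle level `k + k'` that `IsLift.mul` requires.
    have h1 := Gpd.layer_add (σ := σ) hγ k'
    have h2 : γ' ∈ Gpd.layer σ (k + k') (l + k) := by
      have := Gpd.layer_add (σ := σ) hγ' k
      rwa [add_comm k'] at this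
    have h3 : γ.mul γ' h ∈ Gpd.layer σ (i + k') (l + k) := by
      have := Gpd.mul_mem_layer h hγ hγ'
      rwa [add_comm k l] at this
    exact (hS _ _ _ h3).unique ((hS γ _ _ h1).mul (hS γ' _ _ h2) h' h)
  refine ⟨isoOfHom (Λ := trivial hσ)
    { toFun := fun q : Gpd σ × Circle => q.2 • S q.1
      cont := continuous_snd.smul (hcont.comp continuous_fst)
      proj_map := fun q => (Λ.proj_smul _ _).trans (hproj _)
      map_smul := fun z q => Λ.act_mul z q.2 _ } ?_⟩
  intro a b h h'
  have h1 : (Λ.proj (S a.1)).s = (Λ.proj (S b.1)).r := by rw [hproj, hproj]; exact h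
  refine Eq.trans ?_ (Λ.act_mul_act a.2 b.2 (S a.1) (S b.1) h1 h').symm
  exact congrArg (Λ.act (a.2 * b.2)) (hmul a.1 b.1 h h1)

lemma pullbackJ_map (hσ : IsLocalHomeomorph σ) {Λ Μ : Twist σ} (f : Iso Λ Μ) :
    Nonempty (CircleBundle.Iso (Λ.pullbackJ hσ) (Μ.pullbackJ hσ)) :=
  ⟨(CircleBundle.pullbackMap _ _ f.toIso.hom).iso⟩

end Twist

/-! ### The homomorphism induced by `j` and its injectivity. -/

/-- The homomorphism `Tw(Γ) → H¹(X, 𝒮)` given by `Λ ↦ j^*(Λ)`. -/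
noncomputable def pullbackJHom (σ : X → X) (hσ : IsLocalHomeomorph σ) : Tw σ hσ →* H1 X :=
  MonoidHom.mk' (Quotient.map (fun Λ => Λ.pullbackJ hσ) fun _ _ ⟨f⟩ => Twist.pullbackJ_map hσ f) (by
    rintro ⟨Λ⟩ ⟨Μ⟩
    exact Quotient.sound (Setoid.symm ⟨(CircleBundle.pullbackTensor (Gpd.j σ)
      (Gpd.continuous_j hσ) Λ.toCircleBundle Μ.toCircleBundle).iso⟩))

/-- A trivialization of `j^*(Λ)` carries the section `x ↦ (x, 1)` to a continuous section of `Λ`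
over `j`, to which `Twist.nonempty_iso_trivial` applies. -/
lemma pullbackJHom_injective (hσ : IsLocalHomeomorph σ) :
    Function.Injective (pullbackJHom σ hσ) := by
  rw [injective_iff_map_eq_one]
  rintro ⟨Λ⟩ h
  obtain ⟨f⟩ : Nonempty (CircleBundle.Iso (Λ.pullbackJ hσ) (CircleBundle.trivial X)) :=
    Quotient.exact h
  let g := f.inv
  have hg : Continuous fun x : X => (g.toFun (x, (1 : Circle))).1.2 :=
    continuous_snd.comp (continuous_subtype_val.comp
      (g.cont.comp (Continuous.prodMk continuous_id continuous_const)))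
  have hp : ∀ x : X, (g.toFun (x, (1 : Circle))).1.1 = x := fun x => g.proj_map (x, 1)
  exact Quotient.sound (Setoid.symm (Twist.nonempty_iso_trivial hσ Λ _
    (fun x => (g.toFun (x, (1 : Circle))).2.symm.trans (congrArg _ (hp x))) hg))

open CircleBundle

namespace CircleBundle

/-! ### Coordinates with respect to an arbitrary section and to local continuous sections. -/

section Coord

variable (T : CircleBundle X)

lemma exists_point (x : X) : ∃ t : T.E, T.proj t = x := by
  obtain ⟨U, -, hb, -, s, -, -, hs, -⟩ := T.exists_local x
  exact ⟨s x, hs x hb⟩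

/-- A set-theoretic section of a circle bundle. -/
noncomputable def basePt (x : X) : T.E := (T.exists_point x).choose

lemma proj_basePt (x : X) : T.proj (T.basePt x) = x := (T.exists_point x).choose_spec

/-- The coordinate of a point with respect to the section `basePt`. -/
noncomputable def coord (t : T.E) : Circle := T.ratio (T.basePt (T.proj t)) t (T.proj_basePt _)

lemma coord_smul_basePt (t : T.E) : T.coord t • T.basePt (T.proj t) = t :=
  (T.exists_smul (T.proj_basePt (T.proj t))).choose_spec.symm

lemma coord_smul (z : Circle) (t : T.E) : T.coord (z • t) = z * T.coord t := by
  refine ratio_eq _ ?_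
  rw [T.proj_smul, mul_smul, coord_smul_basePt]

lemma coord_basePt (x : X) : T.coord (T.basePt x) = 1 :=
  ratio_eq _ (by rw [T.proj_basePt, _root_.one_smul])

/-- `coord` need not be continuous, as `basePt` is arbitrary. For two points of one fibre the
quotient of the coordinates no longer involves `basePt`: it is the scalar between the points, which
any local trivialization computes continuously. -/
lemma exists_localSection (x₀ : X) : ∃ s : X → T.E, ∀ᶠ x in 𝓝 x₀,
    T.proj (s x) = x ∧ ContinuousAt s x ∧
      ∀ t, T.proj t = x → ContinuousAt (fun t => T.coord t / T.coord (s (T.proj t))) t := by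
  obtain ⟨U, hU, hb, c, s, hc, hsc, hs, hcz, -⟩ := T.exists_local x₀
  refine ⟨s, ?_⟩
  filter_upwards [hU.mem_nhds hb] with x hx
  refine ⟨hs x hx, hsc.continuousAt (hU.mem_nhds hx), ?_⟩
  rintro t rfl
  have hV : IsOpen (T.proj ⁻¹' U) := hU.preimage T.continuous_proj
  have h1 : ContinuousOn (fun t => c t / c (s (T.proj t))) (T.proj ⁻¹' U) :=
    hc.div' (hc.comp (hsc.comp T.continuous_proj.continuousOn fun _ h => h) fun t ht => by
      rw [mem_preimage, hs _ ht]; exact ht)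
  refine (h1.continuousAt (hV.mem_nhds hx)).congr ?_
  filter_upwards [hV.mem_nhds hx] with t' ht'
  have hp := hs _ ht'
  obtain ⟨z, hz⟩ := T.exists_smul hp
  have e1 : c t' = z * c (s (T.proj t')) := by
    conv_lhs => rw [hz]
    exact hcz _ _ (by rw [hp]; exact ht')
  have e2 : T.coord t' = z * T.coord (s (T.proj t')) := by
    conv_lhs => rw [hz]
    exact T.coord_smul _ _
  rw [e1, e2, mul_div_cancel_right, mul_div_cancel_right]

/-- A section of a circle bundle that is continuous near `x₀`. -/
noncomputable def localSection (x₀ : X) : X → T.E := (T.exists_localSection x₀).choose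

/-- The coordinate of the local section near `x₀`. -/
noncomputable def localCoord (x₀ x : X) : Circle := T.coord (T.localSection x₀ x)

/-- The local section near `x₀` is a continuous section at `x`, and the coordinates with respect
to it are continuous over `x`. -/
def IsGoodAt (x₀ x : X) : Prop :=
  T.proj (T.localSection x₀ x) = x ∧ ContinuousAt (T.localSection x₀) x ∧
    ∀ t, T.proj t = x → ContinuousAt (fun t => T.coord t / T.localCoord x₀ (T.proj t)) t

lemma eventually_isGoodAt (x₀ : X) : ∀ᶠ x in 𝓝 x₀, T.IsGoodAt x₀ x :=
  (T.exists_localSection x₀).choose_spec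

/-- This is the transition function between the local sections chosen at `x` and at `x₀`, obtained
by evaluating the coordinate relative to the second on the first. -/
lemma IsGoodAt.continuousAt_div {T : CircleBundle X} {x₀ x : X} (h : T.IsGoodAt x₀ x) :
    ContinuousAt (fun y => T.localCoord x y / T.localCoord x₀ y) x := by
  have hx := (T.eventually_isGoodAt x).self_of_nhds
  have h1 : ContinuousAt (fun y => T.coord (T.localSection x y) /
      T.localCoord x₀ (T.proj (T.localSection x y))) x :=
    ContinuousAt.comp (f := T.localSection x) (h.2.2 _ hx.1) hx.2.1
  refine h1.congr ?_
  filter_upwards [T.eventually_isGoodAt x] with y hy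
  rw [hy.1]
  rfl

/-- The coordinate of the local section of `Λ_T` near `γ₀` at level `k, l`. -/
noncomputable def gpdCoord (k l : ℕ) (γ₀ γ : Gpd σ) : Circle :=
  (∏ i : Fin k, T.localCoord (σ^[i] γ₀.r) (σ^[i] γ.r)) /
    ∏ i : Fin l, T.localCoord (σ^[i] γ₀.s) (σ^[i] γ.s)

variable {T}

/-- The new factors cancel: `σ^k` and `σ^l` take the end points of `γ₀` to one point, likewise those
of `γ`, and the local section depends only on the point at which it is chosen. This makes the charts
compatible with the gluing. -/
lemma gpdCoord_add {k l : ℕ} {γ₀ γ : Gpd σ} (h₀ : γ₀ ∈ Gpd.layer σ k l)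
    (h : γ ∈ Gpd.layer σ k l) (n : ℕ) :
    T.gpdCoord (k + n) (l + n) γ₀ γ = T.gpdCoord k l γ₀ γ := by
  induction n with
  | zero => rfl
  | succ n ih =>
    rw [← ih, gpdCoord, gpdCoord, ← add_assoc, ← add_assoc, Fin.prod_univ_castSucc,
      Fin.prod_univ_castSucc]
    simp only [Fin.val_last, Fin.val_castSucc]
    rw [(Gpd.layer_add h₀ n).1, (Gpd.layer_add h n).1, mul_div_mul_right_eq_div]

lemma gpdCoord_level {k l k' l' : ℕ} {γ₀ γ : Gpd σ} (h₀ : γ₀ ∈ Gpd.layer σ k l)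
    (h : γ ∈ Gpd.layer σ k l) (h₀' : γ₀ ∈ Gpd.layer σ k' l') (h' : γ ∈ Gpd.layer σ k' l') :
    T.gpdCoord k' l' γ₀ γ = T.gpdCoord k l γ₀ γ := by
  rcases Gpd.layer_cases h₀ h₀' with ⟨n, rfl, rfl⟩ | ⟨n, rfl, rfl⟩
  · exact gpdCoord_add h₀ h n
  · exact (gpdCoord_add h₀' h' n).symm

/-- The factors along the orbit of the common point `a.s = b.r` cancel, as the same middle level `k`
is used twice. The continuity of the product on `Λ_T` rests on this identity. -/
lemma gpdCoord_mul {i k l : ℕ} {a₀ a b₀ b : Gpd σ} (h₀ : a₀.s = b₀.r) (h : a.s = b.r) :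
    T.gpdCoord i l (a₀.mul b₀ h₀) (a.mul b h) = T.gpdCoord i k a₀ a * T.gpdCoord k l b₀ b := by
  simp only [gpdCoord, h₀, h]
  exact (div_mul_div_cancel _ _ _).symm

lemma gpdCoord_inv {k l : ℕ} {a₀ a : Gpd σ} :
    T.gpdCoord l k a₀.inv a.inv = (T.gpdCoord k l a₀ a)⁻¹ :=
  (inv_div _ _).symm

variable (T) in
/-- The local sections that define `gpdCoord k l γ₀` are good at `γ`. -/
def GpdGoodAt (k l : ℕ) (γ₀ γ : Gpd σ) : Prop :=
  (∀ i : Fin k, T.IsGoodAt (σ^[i] γ₀.r) (σ^[i] γ.r)) ∧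
    ∀ i : Fin l, T.IsGoodAt (σ^[i] γ₀.s) (σ^[i] γ.s)

variable (T) in
lemma eventually_gpdGoodAt (hσ : IsLocalHomeomorph σ) (k l : ℕ) (γ₀ : Gpd σ) :
    ∀ᶠ γ in 𝓝 γ₀, T.GpdGoodAt k l γ₀ γ := by
  refine (eventually_all.2 fun i => ?_).and (eventually_all.2 fun i => ?_)
  · exact ((hσ.continuous.iterate i).comp Gpd.continuous_r).continuousAt.eventually
      (T.eventually_isGoodAt _)
  · exact ((hσ.continuous.iterate i).comp Gpd.continuous_s).continuousAt.eventually
      (T.eventually_isGoodAt _)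

/-- A transition function of `Λ_T` is a product of transition functions of `T` and their inverses.
-/
lemma GpdGoodAt.continuousAt_div (hσ : IsLocalHomeomorph σ) {k l : ℕ} {γ₀ γ : Gpd σ}
    (h : T.GpdGoodAt k l γ₀ γ) :
    ContinuousAt (fun γ' => T.gpdCoord k l γ γ' / T.gpdCoord k l γ₀ γ') γ := by
  have h1 : ContinuousAt (fun γ' : Gpd σ =>
      (∏ i : Fin k, T.localCoord (σ^[i] γ.r) (σ^[i] γ'.r) /
        T.localCoord (σ^[i] γ₀.r) (σ^[i] γ'.r)) /
      ∏ i : Fin l, T.localCoord (σ^[i] γ.s) (σ^[i] γ'.s) /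
        T.localCoord (σ^[i] γ₀.s) (σ^[i] γ'.s)) γ := by
    refine (tendsto_finsetProd _ fun i _ => ?_).div' (tendsto_finsetProd _ fun i _ => ?_)
    · exact ContinuousAt.comp (f := fun γ' : Gpd σ => σ^[i] γ'.r) (h.1 i).continuousAt_div
        ((hσ.continuous.iterate i).comp Gpd.continuous_r).continuousAt
    · exact ContinuousAt.comp (f := fun γ' : Gpd σ => σ^[i] γ'.s) (h.2 i).continuousAt_div
        ((hσ.continuous.iterate i).comp Gpd.continuous_s).continuousAt
  refine h1.congr (Eventually.of_forall fun γ' => ?_)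
  simp only [Finset.prod_div_distrib, gpdCoord]
  exact div_div_div_comm _ _ _ _

end Coord

/-! ### The glued space as the set `Γ × Circle`, and its topology. -/

section Tuple

variable {T : CircleBundle X} {k l : ℕ}

lemma Tuple.isInducing : IsInducing
    fun p : Tuple T σ k l => (p.base, p.z, p.u, p.v) := ⟨rfl⟩

lemma Tuple.continuous_base : Continuous (Tuple.base : Tuple T σ k l → Gpd σ) :=
  continuous_fst.comp Tuple.isInducing.continuous

lemma Tuple.continuous_z : Continuous (Tuple.z : Tuple T σ k l → Circle) :=
  (continuous_fst.comp continuous_snd).comp Tuple.isInducing.continuous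

lemma Tuple.continuous_u (i : Fin k) : Continuous fun p : Tuple T σ k l => p.u i :=
  (continuous_apply i).comp ((continuous_fst.comp (continuous_snd.comp continuous_snd)).comp
    Tuple.isInducing.continuous)

lemma Tuple.continuous_v (i : Fin l) : Continuous fun p : Tuple T σ k l => p.v i :=
  (continuous_apply i).comp ((continuous_snd.comp (continuous_snd.comp continuous_snd)).comp
    Tuple.isInducing.continuous)

lemma Tuple.continuous_pt : Continuous (Tuple.pt : Tuple T σ k l → GlueSpace T σ) :=
  continuous_quot_mk.comp continuous_sigmaMk

/-- The coordinate of a tuple with respect to the section `basePt`. -/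
noncomputable def Tuple.coord (p : Tuple T σ k l) : Circle :=
  p.z * ((∏ i, T.coord (p.u i)) / ∏ i, T.coord (p.v i))

/-- Dividing by `gpdCoord` compares each entry with the local section chosen at the base point of
the corresponding entry of `p`, and this comparison is continuous there. -/
lemma Tuple.continuousAt_coord (p : Tuple T σ k l) :
    ContinuousAt (fun q : Tuple T σ k l => q.coord / T.gpdCoord k l p.base q.base) p := by
  have h1 : ContinuousAt (fun q : Tuple T σ k l => q.z *
      ((∏ i : Fin k, T.coord (q.u i) / T.localCoord (σ^[i] p.base.r) (T.proj (q.u i))) /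
      ∏ i : Fin l, T.coord (q.v i) / T.localCoord (σ^[i] p.base.s) (T.proj (q.v i)))) p := by
    refine Tuple.continuous_z.continuousAt.mul
      ((tendsto_finsetProd _ fun i _ => ?_).div' (tendsto_finsetProd _ fun i _ => ?_))
    · exact ContinuousAt.comp (f := fun q : Tuple T σ k l => q.u i)
        ((T.eventually_isGoodAt _).self_of_nhds.2.2 _ (p.proj_u i))
        (Tuple.continuous_u i).continuousAt
    · exact ContinuousAt.comp (f := fun q : Tuple T σ k l => q.v i)
        ((T.eventually_isGoodAt _).self_of_nhds.2.2 _ (p.proj_v i))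
        (Tuple.continuous_v i).continuousAt
  refine h1.congr (Eventually.of_forall fun q => ?_)
  simp only [Finset.prod_div_distrib, gpdCoord, q.proj_u, q.proj_v, Tuple.coord]
  rw [div_div_div_comm, mul_div_assoc]

variable (T σ) in
/-- The point of `Γ × Circle` that is represented by an element of the glued space. -/
noncomputable def glueCoord : GlueSpace T σ → Gpd σ × Circle :=
  Quot.lift (fun n => (n.2.base, n.2.coord)) (by
    rintro _ _ (⟨p, q, a, b, hbase, hu, hv, hz⟩ | ⟨p, q, w, hbase, hu, hv, hw, hz⟩)
    -- A `star` identification moves scalars from the entries to `z`, and leaves the total product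
    -- unchanged.
    · refine Prod.ext hbase ?_
      simp only [Tuple.coord, hu, hv, hz, coord_smul, Finset.prod_mul_distrib, div_eq_mul_inv,
        mul_inv]
      exact (show ∀ z a u b v : Circle, z * (a * u * (b * v)) = z * a * b * (u * v)
        from fun z a u b v => by ac_rfl) _ _ _ _ _
    -- In a `glue` identification the coordinate of the last `v` cancels against that of `u = w v`;
    -- what remains is `w`.
    · refine Prod.ext hbase ?_
      simp only [Tuple.coord, Fin.prod_univ_castSucc, hu, hv, hw, hz, coord_smul, div_eq_mul_inv,
        mul_inv]
      rw [show ∀ A B C z w : Circle, z * (A * (w * C) * (B * C⁻¹)) = z * w * (A * B) * (C * C⁻¹)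
        from fun A B C z w => by ac_rfl, mul_inv_cancel, _root_.mul_one])

variable (T) in
/-- The tuple over `γ` with scalar `z` whose entries are the values of the section `basePt`. -/
noncomputable def baseTuple (γ : Gpd σ) (hγ : γ ∈ Gpd.layer σ k l) (z : Circle) : Tuple T σ k l where
  base := γ
  z := z
  u i := T.basePt (σ^[i] γ.r)
  v i := T.basePt (σ^[i] γ.s)
  base_mem := hγ
  proj_u _ := T.proj_basePt _
  proj_v _ := T.proj_basePt _

lemma coord_baseTuple (γ : Gpd σ) (hγ : γ ∈ Gpd.layer σ k l) (z : Circle) :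
    (baseTuple T γ hγ z).coord = z := by
  simp [Tuple.coord, baseTuple, coord_basePt]

/-- A normal form: one `star` identification takes the coordinates of all entries into the scalar
and leaves only base points. -/
lemma Tuple.pt_eq (p : Tuple T σ k l) : p.pt = (baseTuple T p.base p.base_mem p.coord).pt := by
  refine Quot.sound (GlueRel.star p _ (fun i => T.coord (p.u i)) (fun i => T.coord (p.v i)) rfl
    (fun i => ?_) (fun i => ?_) ?_)
  · conv_lhs => rw [← T.coord_smul_basePt (p.u i), p.proj_u]
    rfl
  · conv_lhs => rw [← T.coord_smul_basePt (p.v i), p.proj_v]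
    rfl
  · simp only [baseTuple, Tuple.coord, div_eq_mul_inv, mul_assoc]

/-- The last entries are base points over the same point of `X`, hence equal, so they can be removed
with `w = 1`. -/
lemma baseTuple_pt_add (γ : Gpd σ) (hγ : γ ∈ Gpd.layer σ k l) (z : Circle) (n : ℕ) :
    (baseTuple T γ (Gpd.layer_add hγ n) z).pt = (baseTuple T γ hγ z).pt := by
  induction n with
  | zero => rfl
  | succ n ih =>
    rw [← ih]
    refine Quot.sound (GlueRel.glue _ _ 1 rfl (fun _ => rfl) (fun _ => rfl) ?_ ?_)
    · rw [_root_.one_smul]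
      exact congrArg T.basePt (Gpd.layer_add hγ n).1
    · exact (_root_.mul_one z).symm

lemma glueCoord_bijective : Function.Bijective (glueCoord σ T) := by
  constructor
  · rintro ⟨⟨k, l⟩, p⟩ ⟨⟨k', l'⟩, q⟩ h
    obtain ⟨h1, h2⟩ : p.base = q.base ∧ p.coord = q.coord := Prod.ext_iff.1 h
    change p.pt = q.pt
    have hq := h1 ▸ q.base_mem
    have e : (baseTuple T q.base q.base_mem q.coord).pt = (baseTuple T p.base hq p.coord).pt := by
      congr 1
      simp only [h1, h2]
    rw [p.pt_eq, q.pt_eq, e]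
    -- The two normal forms now differ at most in their levels, and these are comparable.
    rcases Gpd.layer_cases p.base_mem hq with ⟨n, rfl, rfl⟩ | ⟨n, rfl, rfl⟩
    · exact (baseTuple_pt_add _ _ _ n).symm
    · exact baseTuple_pt_add _ hq _ n
  · rintro ⟨γ, z⟩
    obtain ⟨k, l, hγ⟩ := γ.mem
    exact ⟨(baseTuple T γ (k := k) (l := l) hγ z).pt, Prod.ext rfl (coord_baseTuple _ _ _)⟩

variable (T σ) in
/-- The glued space is, as a set, the product `Γ × Circle`. -/
noncomputable def glueEquiv : GlueSpace T σ ≃ Gpd σ × Circle :=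
  Equiv.ofBijective (glueCoord σ T) glueCoord_bijective

lemma glueEquiv_pt (p : Tuple T σ k l) : glueEquiv σ T p.pt = (p.base, p.coord) := rfl

lemma continuous_glueEquiv_fst : Continuous fun e => (glueEquiv σ T e).1 :=
  (isQuotientMap_quot_mk (r := GlueRel T σ)).continuous_iff.2
    (continuous_sigma fun _ => Tuple.continuous_base)

/-- Near every point of `Γ`, the coordinate with respect to a local section is continuous. -/
lemma exists_chart (hσ : IsLocalHomeomorph σ) {γ₀ : Gpd σ} (h₀ : γ₀ ∈ Gpd.layer σ k l) :
    ∃ U : Set (Gpd σ), IsOpen U ∧ γ₀ ∈ U ∧ U ⊆ Gpd.layer σ k l ∧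
      (∀ γ ∈ U, T.GpdGoodAt k l γ₀ γ) ∧
      ContinuousOn (fun e => (glueEquiv σ T e).2 / T.gpdCoord k l γ₀ (glueEquiv σ T e).1)
        ((fun e => (glueEquiv σ T e).1) ⁻¹' U) := by
  obtain ⟨U, hUs, hU, hγU⟩ := mem_nhds_iff.1
    (inter_mem ((Gpd.isOpen_layer k l).mem_nhds h₀) (T.eventually_gpdGoodAt hσ k l γ₀))
  refine ⟨U, hU, hγU, fun γ h => (hUs h).1, fun γ h => (hUs h).2, ?_⟩
  have hq : IsQuotientMap (Quot.mk (GlueRel T σ) : _ → GlueSpace T σ) := isQuotientMap_quot_mk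
  refine (hq.continuousOn_isOpen_iff (hU.preimage continuous_glueEquiv_fst)).2 ?_
  -- Continuity on the quotient is tested on every `T_{k',l'}`, also at levels other than that of
  -- the chart.
  rintro ⟨⟨k', l'⟩, p⟩ hp
  have hp : p.base ∈ U := hp
  have hp' : p.base ∈ Gpd.layer σ k' l' := p.base_mem
  refine ContinuousAt.continuousWithinAt ?_
  rw [ContinuousAt, Sigma.nhds_mk, tendsto_map'_iff]
  change ContinuousAt (fun q : Tuple T σ k' l' => q.coord / T.gpdCoord k l γ₀ q.base) p
  -- The coordinate relative to the local sections at `p.base`, at the level of `p`, times the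
  -- transition function to those at `γ₀`, at the level of the chart. Over `U` the two levels give
  -- the same `gpdCoord` for `p.base`, so the intermediate term cancels.
  have h1 := p.continuousAt_coord.mul (ContinuousAt.comp (f := Tuple.base)
    ((hUs hp).2.continuousAt_div hσ) Tuple.continuous_base.continuousAt)
  refine h1.congr ?_
  filter_upwards [Tuple.continuous_base.continuousAt.eventually (hU.mem_nhds hp)] with q hq
  change q.coord / T.gpdCoord k' l' p.base q.base *
    (T.gpdCoord k l p.base q.base / T.gpdCoord k l γ₀ q.base) = _
  rw [gpdCoord_level (hUs hp).1 (hUs hq).1 hp' q.base_mem, div_mul_div_cancel]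

/-- A map into the glued space is continuous at a point if its projection to `Γ` and its coordinate
with respect to a local section are. -/
lemma continuousAt_glueSpace (hσ : IsLocalHomeomorph σ) {Y : Type*} [TopologicalSpace Y]
    {f : Y → GlueSpace T σ} {y₀ : Y} (h₀ : (glueEquiv σ T (f y₀)).1 ∈ Gpd.layer σ k l)
    (h1 : ContinuousAt (fun y => (glueEquiv σ T (f y)).1) y₀)
    (h2 : ContinuousAt (fun y => (glueEquiv σ T (f y)).2 /
      T.gpdCoord k l (glueEquiv σ T (f y₀)).1 (glueEquiv σ T (f y)).1) y₀) :
    ContinuousAt f y₀ := by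
  set γ₀ := (glueEquiv σ T (f y₀)).1
  have hev := (h1.eventually ((Gpd.isOpen_layer k l).mem_nhds h₀)).and
    (h1.eventually (T.eventually_gpdGoodAt hσ k l γ₀))
  -- Near `y₀` the map `f` is lifted to `T_{k,l}`: the entries are the values of the local sections
  -- at `γ₀`, and the scalar is the chart coordinate of `f y`. The lift is continuous at `y₀`, and
  -- its class is `f y`.
  have tup : ∀ γ : Gpd σ, γ ∈ Gpd.layer σ k l → T.GpdGoodAt k l γ₀ γ → ∀ z : Circle,
      ∃ p : Tuple T σ k l, (p.base, p.z, p.u, p.v) = (γ, z,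
        (fun i : Fin k => T.localSection (σ^[i] γ₀.r) (σ^[i] γ.r)),
        (fun i : Fin l => T.localSection (σ^[i] γ₀.s) (σ^[i] γ.s))) :=
    fun γ hγ hg z => ⟨⟨γ, z, _, _, hγ, fun i => (hg.1 i).1, fun i => (hg.2 i).1⟩, rfl⟩
  have key : ∀ y, ∃ p : Tuple T σ k l, (glueEquiv σ T (f y)).1 ∈ Gpd.layer σ k l ∧
      T.GpdGoodAt k l γ₀ (glueEquiv σ T (f y)).1 → (p.base, p.z, p.u, p.v) =
        ((glueEquiv σ T (f y)).1,
        (glueEquiv σ T (f y)).2 / T.gpdCoord k l γ₀ (glueEquiv σ T (f y)).1,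
        (fun i : Fin k => T.localSection (σ^[i] γ₀.r) (σ^[i] (glueEquiv σ T (f y)).1.r)),
        (fun i : Fin l => T.localSection (σ^[i] γ₀.s) (σ^[i] (glueEquiv σ T (f y)).1.s))) := by
    intro y
    by_cases h : (glueEquiv σ T (f y)).1 ∈ Gpd.layer σ k l ∧
      T.GpdGoodAt k l γ₀ (glueEquiv σ T (f y)).1
    · obtain ⟨p, hp⟩ := tup _ h.1 h.2 _
      exact ⟨p, fun _ => hp⟩
    -- A default value, needed only away from `y₀`.
    · exact ⟨baseTuple T γ₀ h₀ 1, fun h' => absurd h' h⟩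
  choose p hp using key
  have hpc : ContinuousAt p y₀ := by
    rw [Tuple.isInducing.continuousAt_iff]
    have hg := hev.self_of_nhds.2
    have h3 : ContinuousAt (fun y => ((glueEquiv σ T (f y)).1,
        (glueEquiv σ T (f y)).2 / T.gpdCoord k l γ₀ (glueEquiv σ T (f y)).1,
        (fun i : Fin k => T.localSection (σ^[i] γ₀.r) (σ^[i] (glueEquiv σ T (f y)).1.r)),
        (fun i : Fin l => T.localSection (σ^[i] γ₀.s) (σ^[i] (glueEquiv σ T (f y)).1.s)))) y₀ := by
      refine h1.prodMk (h2.prodMk ((continuousAt_pi.2 fun i => ?_).prodMk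
        (continuousAt_pi.2 fun i => ?_)))
      · exact ContinuousAt.comp (f := fun y => σ^[i] (glueEquiv σ T (f y)).1.r) (hg.1 i).2.1
          (((hσ.continuous.iterate i).comp Gpd.continuous_r).continuousAt.comp h1)
      · exact ContinuousAt.comp (f := fun y => σ^[i] (glueEquiv σ T (f y)).1.s) (hg.2 i).2.1
          (((hσ.continuous.iterate i).comp Gpd.continuous_s).continuousAt.comp h1)
    refine h3.congr ?_
    filter_upwards [hev] with y hy
    exact (hp y hy).symm
  refine (Tuple.continuous_pt.continuousAt.comp hpc).congr ?_
  filter_upwards [hev] with y hy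
  apply (glueEquiv σ T).injective
  simp only [Function.comp_apply, glueEquiv_pt]
  have e := hp y hy
  simp only [Prod.mk.injEq] at e
  obtain ⟨e1, e2, e3, e4⟩ := e
  refine Prod.ext e1 ?_
  simp only [Tuple.coord, e2, e3, e4]
  exact div_mul_cancel _ _

lemma continuousAt_glueEquiv_symm (hσ : IsLocalHomeomorph σ) {Y : Type*} [TopologicalSpace Y]
    {f : Y → Gpd σ} {g : Y → Circle} {y₀ : Y} (h₀ : f y₀ ∈ Gpd.layer σ k l)
    (h1 : ContinuousAt f y₀)
    (h2 : ContinuousAt (fun y => g y / T.gpdCoord k l (f y₀) (f y)) y₀) :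
    ContinuousAt (fun y => (glueEquiv σ T).symm (f y, g y)) y₀ := by
  refine continuousAt_glueSpace (k := k) (l := l) hσ ?_ ?_ ?_ <;>
    simp only [Equiv.apply_symm_apply] <;> assumption

/-- The counterpart of `continuousAt_glueEquiv_symm`. Between them, continuity of an operation on
the glued space reduces to an identity for `gpdCoord`. -/
lemma continuousAt_glueEquiv_snd (hσ : IsLocalHomeomorph σ) {Y : Type*} [TopologicalSpace Y]
    {f : Y → GlueSpace T σ} {y₀ : Y} (hf : ContinuousAt f y₀)
    (h₀ : (glueEquiv σ T (f y₀)).1 ∈ Gpd.layer σ k l) :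
    ContinuousAt (fun y => (glueEquiv σ T (f y)).2 /
      T.gpdCoord k l (glueEquiv σ T (f y₀)).1 (glueEquiv σ T (f y)).1) y₀ := by
  obtain ⟨U, hU, hγU, -, -, hc⟩ := exists_chart (T := T) hσ h₀
  exact ContinuousAt.comp (g := fun e => (glueEquiv σ T e).2 /
    T.gpdCoord k l (glueEquiv σ T (f y₀)).1 (glueEquiv σ T e).1)
    (hc.continuousAt ((hU.preimage continuous_glueEquiv_fst).mem_nhds hγU)) hf

end Tuple

/-! ### The bundle and groupoid structure of `Λ_T`. -/

variable (T : CircleBundle X)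

lemma continuous_glueAct (hσ : IsLocalHomeomorph σ) :
    Continuous fun q : Circle × GlueSpace T σ => (glueEquiv σ T).symm
      ((glueEquiv σ T q.2).1, q.1 * (glueEquiv σ T q.2).2) := by
  rw [continuous_iff_continuousAt]
  rintro ⟨w, e⟩
  obtain ⟨k, l, h₀⟩ := (glueEquiv σ T e).1.mem
  have h₀ : (glueEquiv σ T e).1 ∈ Gpd.layer σ k l := h₀
  have d := continuousAt_glueEquiv_snd (f := fun q : Circle × GlueSpace T σ => q.2)
    (y₀ := (w, e)) hσ continuous_snd.continuousAt h₀
  refine continuousAt_glueEquiv_symm (k := k) (l := l) hσ h₀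
    (continuous_glueEquiv_fst.comp continuous_snd).continuousAt ?_
  exact (continuous_fst.continuousAt.mul d).congr
    (Eventually.of_forall fun q => (mul_div_assoc _ _ _).symm)

/-- The circle bundle over `Γ` underlying `Λ_T`. -/
noncomputable def glueBundle (hσ : IsLocalHomeomorph σ) : CircleBundle (Gpd σ) :=
  { E := GlueSpace T σ
    act := fun z e => (glueEquiv σ T).symm ((glueEquiv σ T e).1, z * (glueEquiv σ T e).2)
    act_one := fun e => by simp
    act_mul := fun z w e => by simp [mul_assoc]
    continuous_act := T.continuous_glueAct hσ
    proj := fun e => (glueEquiv σ T e).1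
    proj_act := fun z e => by simp
    locTriv := fun γ₀ => by
      obtain ⟨k, l, h₀⟩ := γ₀.mem
      obtain ⟨U, hU, hγU, hUl, hUg, hc⟩ := exists_chart (T := T) (k := k) (l := l) hσ h₀
      -- The local section has scalar `gpdCoord k l γ₀ γ`, so its chart coordinate is `1`. Its
      -- continuity at `γ` is that of the inverse of a transition function.
      refine locTriv_of
        (m := fun z e => (glueEquiv σ T).symm ((glueEquiv σ T e).1, z * (glueEquiv σ T e).2))
        (s := fun γ => (glueEquiv σ T).symm (γ, T.gpdCoord k l γ₀ γ))
        (T.continuous_glueAct hσ) continuous_glueEquiv_fst (fun z e => by simp)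
        (fun x y h => ?_) hU hγU hc (fun γ hγ => ContinuousAt.continuousWithinAt ?_) (fun γ _ => by simp)
        (fun z e _ => by simp [mul_div_assoc])
      · refine ⟨(glueEquiv σ T y).2 / (glueEquiv σ T x).2, ?_⟩
        rw [Equiv.eq_symm_apply, div_mul_cancel, h]
      · exact continuousAt_glueEquiv_symm (f := fun γ => γ) (k := k) (l := l) hσ (hUl hγ)
          continuousAt_id (((hUg γ hγ).continuousAt_div hσ).inv.congr
            (Eventually.of_forall fun _ => inv_div _ _)) }

lemma continuous_glueMul (hσ : IsLocalHomeomorph σ) :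
    Continuous fun q : {q : GlueSpace T σ × GlueSpace T σ //
        (glueEquiv σ T q.1).1.s = (glueEquiv σ T q.2).1.r} => (glueEquiv σ T).symm
      ((glueEquiv σ T q.1.1).1.mul (glueEquiv σ T q.1.2).1 q.2,
        (glueEquiv σ T q.1.1).2 * (glueEquiv σ T q.1.2).2) := by
  rw [continuous_iff_continuousAt]
  rintro ⟨⟨a, b⟩, h⟩
  obtain ⟨i, k, ha⟩ := (glueEquiv σ T a).1.mem
  obtain ⟨k', l, hb⟩ := (glueEquiv σ T b).1.mem
  -- The factors are brought to the common middle level `k + k'`. There the chart coordinate of the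
  -- product is the product of the chart coordinates.
  have ha' : (glueEquiv σ T a).1 ∈ Gpd.layer σ (i + k') (k + k') := Gpd.layer_add ha k'
  have hb' : (glueEquiv σ T b).1 ∈ Gpd.layer σ (k + k') (l + k) := by
    have := Gpd.layer_add (σ := σ) hb k
    rwa [add_comm k'] at this
  have hab : (glueEquiv σ T a).1.mul (glueEquiv σ T b).1 h ∈ Gpd.layer σ (i + k') (l + k) := by
    have := Gpd.mul_mem_layer h ha hb
    rwa [add_comm k l] at this
  have c1 : Continuous fun q : {q : GlueSpace T σ × GlueSpace T σ //
      (glueEquiv σ T q.1).1.s = (glueEquiv σ T q.2).1.r} => q.1.1 :=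
    continuous_fst.comp continuous_subtype_val
  have c2 : Continuous fun q : {q : GlueSpace T σ × GlueSpace T σ //
      (glueEquiv σ T q.1).1.s = (glueEquiv σ T q.2).1.r} => q.1.2 :=
    continuous_snd.comp continuous_subtype_val
  have d1 := continuousAt_glueEquiv_snd (y₀ := ⟨(a, b), h⟩) hσ c1.continuousAt ha'
  have d2 := continuousAt_glueEquiv_snd (y₀ := ⟨(a, b), h⟩) hσ c2.continuousAt hb'
  refine continuousAt_glueEquiv_symm (k := i + k') (l := l + k) hσ hab
    (Continuous.continuousAt ?_) ?_
  · exact (Gpd.continuous_mul hσ).comp (f := fun q : {q : GlueSpace T σ × GlueSpace T σ //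
      (glueEquiv σ T q.1).1.s = (glueEquiv σ T q.2).1.r} =>
      (⟨((glueEquiv σ T q.1.1).1, (glueEquiv σ T q.1.2).1), q.2⟩ :
        {q : Gpd σ × Gpd σ // q.1.s = q.2.r})) (Continuous.subtype_mk
      ((continuous_glueEquiv_fst.comp c1).prodMk (continuous_glueEquiv_fst.comp c2)) _)
  · refine (d1.mul d2).congr (Eventually.of_forall fun q => ?_)
    dsimp only [Pi.mul_apply]
    rw [gpdCoord_mul (k := k + k'), div_mul_div_comm]

lemma continuous_glueInv (hσ : IsLocalHomeomorph σ) :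
    Continuous fun e : GlueSpace T σ => (glueEquiv σ T).symm
      ((glueEquiv σ T e).1.inv, (glueEquiv σ T e).2⁻¹) := by
  rw [continuous_iff_continuousAt]
  intro e
  obtain ⟨k, l, h₀⟩ := (glueEquiv σ T e).1.mem
  refine continuousAt_glueEquiv_symm (k := l) (l := k) hσ
    ⟨h₀.1.symm, by simp [Gpd.inv, ← h₀.2]⟩
    ((Gpd.continuous_inv hσ).comp continuous_glueEquiv_fst).continuousAt ?_
  refine (continuousAt_glueEquiv_snd hσ continuousAt_id h₀).inv.congr
    (Eventually.of_forall fun q => ?_)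
  dsimp only [Pi.inv_apply, id]
  rw [gpdCoord_inv (k := k), inv_div_inv, inv_div]

lemma continuous_glueOne (hσ : IsLocalHomeomorph σ) :
    Continuous fun x => (glueEquiv σ T).symm (Gpd.unit σ x, 1) := by
  rw [continuous_iff_continuousAt]
  intro x
  refine continuousAt_glueEquiv_symm (k := 0) (l := 0) hσ ⟨rfl, by simp [Gpd.unit]⟩
    (Gpd.continuous_unit hσ).continuousAt ?_
  -- At level `(0, 0)` both products in `gpdCoord` are empty.
  simpa [gpdCoord] using continuousAt_const

/-- The twist `Λ_T` of a circle bundle `T`. -/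
noncomputable def glueTwist (hσ : IsLocalHomeomorph σ) : Twist σ where
  toCircleBundle := T.glueBundle hσ
  mul a b h := (glueEquiv σ T).symm
    ((glueEquiv σ T a).1.mul (glueEquiv σ T b).1 h, (glueEquiv σ T a).2 * (glueEquiv σ T b).2)
  one x := (glueEquiv σ T).symm (Gpd.unit σ x, 1)
  inv a := (glueEquiv σ T).symm ((glueEquiv σ T a).1.inv, (glueEquiv σ T a).2⁻¹)
  proj_mul a b h := by simp [glueBundle]
  proj_one x := by simp [glueBundle]
  proj_inv a := by simp [glueBundle]
  -- Under `glueEquiv` the operations are those of `Γ × Circle`, where the groupoid axioms hold in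
  -- each component.
  mul_assoc a b c h₁ h₂ h₃ h₄ := by
    refine congrArg _ (Prod.ext (Gpd.ext ?_ ?_ ?_) ?_) <;>
      simp [Gpd.mul, add_assoc, _root_.mul_assoc]
  one_mul a h := by
    refine (Equiv.symm_apply_eq _).2 (Prod.ext (Gpd.ext ?_ ?_ ?_) ?_) <;>
      simp [Gpd.mul, Gpd.unit, glueBundle] <;> rfl
  mul_one a h := by
    refine (Equiv.symm_apply_eq _).2 (Prod.ext (Gpd.ext ?_ ?_ ?_) ?_) <;>
      simp [Gpd.mul, Gpd.unit, glueBundle] <;> rfl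
  inv_mul a h := by
    refine congrArg _ (Prod.ext (Gpd.ext ?_ ?_ ?_) ?_) <;>
      simp [Gpd.mul, Gpd.unit, Gpd.inv, glueBundle]
  mul_inv a h := by
    refine congrArg _ (Prod.ext (Gpd.ext ?_ ?_ ?_) ?_) <;>
      simp [Gpd.mul, Gpd.unit, Gpd.inv, glueBundle]
  act_mul_act z w a b h h' := by
    refine congrArg _ (Prod.ext (Gpd.ext ?_ ?_ ?_) ?_) <;>
      simp [Gpd.mul, glueBundle, mul_mul_mul_comm]
  continuous_mul := T.continuous_glueMul hσ
  continuous_one := T.continuous_glueOne hσ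
  continuous_inv := T.continuous_glueInv hσ

/-- The homeomorphism is the identity, as the total space is the glued space itself. The formulas on
tuples agree with the transported operations because both sides have the same base and the same
coordinate. -/
lemma isTwistOf_glueTwist (hσ : IsLocalHomeomorph σ) :
    T.IsTwistOf (T.glueTwist hσ) := by
  refine ⟨Homeomorph.refl _, fun k l p => rfl, ?_, ?_, ?_⟩
  · intro k l p w
    exact (Equiv.eq_symm_apply (glueEquiv σ T)).2 (Prod.ext rfl (mul_assoc _ _ _))
  · intro i k l p q pq a hc hc' hqa hbase hu hv hz
    refine (Equiv.symm_apply_eq (glueEquiv σ T)).2 (Prod.ext hbase.symm ?_)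
    change p.coord * q.coord = pq.coord
    simp only [Tuple.coord, hu, hv, hz, hqa, coord_smul, Finset.prod_mul_distrib, div_eq_mul_inv]
    -- `B` is the product of the coordinates of `p.v`; it cancels against its copy in those of `q.u
    -- = a p.v`, leaving `∏ a`.
    rw [show ∀ z A B w a C : Circle, z * (A * B⁻¹) * (w * (a * B * C)) =
      z * w * a * (A * C) * (B * B⁻¹) from fun z A B w a C => by ac_rfl, mul_inv_cancel, mul_one]
  · intro k l p q hbase hu hv hz
    refine (Equiv.symm_apply_eq (glueEquiv σ T)).2 (Prod.ext hbase.symm ?_)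
    change p.coord⁻¹ = q.coord
    simp only [Tuple.coord, hu, hv, hz, mul_inv, inv_div]

/-! ### The restriction of `Λ_T` along `j`. -/

/-- The point of `T_{1,0}` given by a point of `T`. -/
def singleTuple (σ : X → X) (z : Circle) (t : T.E) : Tuple T σ 1 0 where
  base := Gpd.j σ (T.proj t)
  z := z
  u _ := t
  v := Fin.elim0
  base_mem := ⟨rfl, by simp [Gpd.j]⟩
  proj_u i := by rw [Subsingleton.elim i 0]; rfl
  proj_v i := i.elim0

/-- A point `t` of `T`, read as a tuple of level `(1, 0)`, is a point of `Λ` over `j(p(t))`. This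
map is continuous and equivariant over `X`, and such a map is automatically an isomorphism. -/
lemma nonempty_iso_of_isTwistOf {T : CircleBundle X} (hσ : IsLocalHomeomorph σ) {Λ : Twist σ}
    (h : T.IsTwistOf Λ) : Nonempty (Iso T (Λ.pullbackJ hσ)) := by
  obtain ⟨h, hp, hs, -, -⟩ := h
  have hc : Continuous (singleTuple T σ 1) := by
    rw [Tuple.isInducing.continuous_iff]
    exact ((Gpd.continuous_j hσ).comp T.continuous_proj).prodMk (continuous_const.prodMk
      ((continuous_pi fun _ => continuous_id).prodMk continuous_const))
  refine ⟨Hom.iso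
    { toFun := fun t => ⟨(T.proj t, h (singleTuple T σ 1 t).pt), (hp 1 0 (singleTuple T σ 1 t)).symm⟩
      cont := Continuous.subtype_mk (T.continuous_proj.prodMk
        (h.continuous.comp (Tuple.continuous_pt.comp hc))) _
      proj_map := fun _ => rfl
      map_smul := fun z t => Subtype.ext (Prod.ext (T.proj_smul z t) ?_) }⟩
  refine Eq.trans ?_ (hs 1 0 (singleTuple T σ 1 t) z)
  -- A `star` identification moves `z` from the only entry to the scalar.
  refine congrArg h (Quot.sound (GlueRel.star _ _ (fun _ => z) Fin.elim0 ?_ (fun _ => rfl)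
    (fun i => i.elim0) ?_))
  · exact congrArg (Gpd.j σ) (T.proj_smul z t)
  · simp [singleTuple]

end CircleBundle

end CircleTwist

theorem theorem3p1 {X : Type u} [TopologicalSpace X] [SecondCountableTopology X]
    [LocallyCompactSpace X] [T2Space X] (σ : X → X) (hσ : IsLocalHomeomorph σ) :
    ∃ Φ : Tw σ hσ ≃* H1 X,
      (∀ Λ : Twist σ, Φ (Λ.cls hσ) = (Λ.pullbackJ hσ).cls) ∧
      ∀ T : CircleBundle X,
        (∃ Λ : Twist σ, T.IsTwistOf Λ) ∧
        ∀ Λ : Twist σ, T.IsTwistOf Λ → Φ.symm T.cls = Λ.cls hσ := by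
  -- Stated for every model of `Λ_T`: the model `glueTwist` gives surjectivity, and injectivity then
  -- determines the class of every other model.
  have key : ∀ (T : CircleBundle X) (Λ : Twist σ), T.IsTwistOf Λ →
      pullbackJHom σ hσ (Λ.cls hσ) = T.cls := fun T Λ h =>
    Quotient.sound (Setoid.symm (CircleBundle.nonempty_iso_of_isTwistOf hσ h))
  have hbij : Function.Bijective (pullbackJHom σ hσ) := by
    refine ⟨pullbackJHom_injective hσ, ?_⟩
    rintro ⟨T⟩
    exact ⟨_, key T _ (T.isTwistOf_glueTwist hσ)⟩
  refine ⟨MulEquiv.ofBijective (pullbackJHom σ hσ) hbij, fun Λ => rfl, fun T =>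
    ⟨⟨_, T.isTwistOf_glueTwist hσ⟩, fun Λ h => ?_⟩⟩
  rw [MulEquiv.symm_apply_eq]
  exact (key T Λ h).symm
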